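/- For a nonempty finite set $Q\subset\mathbb{R}$ let $\mu(Q)=\frac{1}{|Q|}\sum_{x\in Q}x$ and $\Delta(Q)=\sum_{x\in Q}(x-\mu(Q))^2$, and for finite sets $A,B\subset\mathbb{R}$ let $D(A,B)=\Delta(A\cup B)-\Delta(A)-\Delta(B)$. For a finite set $P\subset\mathbb{R}$ and an integer $k\ge 1$ let $$\mathrm{opt}_k(P)=\min_{C\subset\mathbb{R},\ |C|=k}\ \sum_{p\in P}\min_{c\in C}(p-c)^2$$ be the optimal value of the $k$-means objective. Ward's method on $P$, where $n=|P|$, starts with the clustering $\mathcal{W}_0=\{\{x\}\mid x\in P\}$ and performs $n-1$ merges: in step $i$ it chooses two distinct clusters $A,B\in\mathcal{W}_{i-1}$ for which $D(A,B)$ is minimal (ties are broken arbitrarily) and sets $\mathcal{W}_i=(\mathcal{W}_{i-1}\setminus\{A,B\})\cup\{A\cup B\}$. For $1\le k\le n$, the $k$-clustering that it computes is $\mathcal{W}_{n-k}$, and its cost is $\sum_{Q\in\mathcal{W}_{n-k}}\Delta(Q)$. Theorem. There is a universal constant $\alpha$ such that for every finite set $P\subset\mathbb{R}$, every integer $k$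 with $1\le k\le |P|$, and every possible run $\mathcal{W}_0,\ldots,\mathcal{W}_{|P|-1}$ of Ward's method on $P$, $$\sum_{Q\in\mathcal{W}_{|P|-k}}\Delta(Q)\ \le\ \alpha\cdot \mathrm{opt}_k(P).$$ That is, on one-dimensional instances the $k$-clustering computed by Ward's method is an $\mathcal{O}(1)$-approximation with respect to the $k$-means objective, for every $k$. -/

import Mathlib

noncomputable section

namespace Ward

/-- The centroid `μ(Q)` of a finite (nonempty) set of points on the line. -/
def centroid (Q : Finset ℝ) : ℝ := (∑ x ∈ Q, x) / (Q.card : ℝ)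

/-- `Δ(Q, c)`: the sum of the squared distances of the points of `Q` to the center `c`. -/
def costAt (Q : Finset ℝ) (c : ℝ) : ℝ := ∑ x ∈ Q, (x - c) ^ 2

/-- The 1-means cost `Δ(Q) = Δ(Q, μ(Q))`. -/
def cost (Q : Finset ℝ) : ℝ := costAt Q (centroid Q)

/-- `D(A, B) = Δ(A ∪ B) - Δ(A) - Δ(B)`: the cost of merging `A` and `B`. -/
def mergeCost (A B : Finset ℝ) : ℝ := cost (A ∪ B) - cost A - cost B

/-- The k-means objective `Δ(P, C) = ∑_{p ∈ P} min_{c ∈ C} |p - c|²` of a nonempty finite set `C`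
of centers. -/
def kMeansCost (P C : Finset ℝ) : ℝ := ∑ p ∈ P, ⨅ c : C, (p - (c : ℝ)) ^ 2

/-- `opt_k(P)` for `k ≥ 1`: the optimal value of the k-means objective over all sets of exactly
`k` centers on the line. -/
def opt (k : ℕ) (P : Finset ℝ) : ℝ := sInf {v : ℝ | ∃ C : Finset ℝ, C.card = k ∧ kMeansCost P C = v}

/-- The clustering that results from `𝒞` by merging its clusters `A` and `B`. -/
def merge (𝒞 : Finset (Finset ℝ)) (A B : Finset ℝ) : Finset (Finset ℝ) :=
  insert (A ∪ B) (𝒞 \ {A, B})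

/-- Two different clusters of `𝒞` form a greedy merge if no merge of two different clusters of
`𝒞` is cheaper. -/
def IsGreedyMerge (𝒞 : Finset (Finset ℝ)) (A B : Finset ℝ) : Prop :=
  A ∈ 𝒞 ∧ B ∈ 𝒞 ∧ A ≠ B ∧
    ∀ A' ∈ 𝒞, ∀ B' ∈ 𝒞, A' ≠ B' → mergeCost A B ≤ mergeCost A' B'

/-- `W 0, …, W (|P| - 1)` is a possible run of Ward's method on `P`: it starts with the singleton
clusters and performs `|P| - 1` greedy merges (ties broken in any way). Only the clusterings with
index less than `|P|` matter. -/
structure IsWardClustering (P : Finset ℝ) (W : ℕ → Finset (Finset ℝ)) : Prop where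
  init : W 0 = P.image fun x => {x}
  step : ∀ i : ℕ, i + 1 < P.card → ∃ A B : Finset ℝ,
    IsGreedyMerge (W i) A B ∧ W (i + 1) = merge (W i) A B

/-- The k-means cost `∑_Q Δ(Q)` of the `k`-clustering (the one after `|P| - k` merges) contained
in the hierarchical clustering `W` of `P`, for `1 ≤ k ≤ |P|`. -/
def hierarchicalCost (P : Finset ℝ) (W : ℕ → Finset (Finset ℝ)) (k : ℕ) : ℝ :=
  ∑ Q ∈ W (P.card - k), cost Q

end Ward

end

namespace Ward

/-! Let `e t` be the cost of merge `t`. Singletons cost nothing, so the `k`-clustering costs the sum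
of `e t` over the first `J = |P| - k` merges. On the line clusters stay sets of consecutive points
(`not_greedy_of_between`), and `e` is nondecreasing (`mergeCost_le_mergeCost_union`). Any `k`
centers color `P` with at most `k` intervals; let OPT be the cost of this coloring.

Call a cluster pure if it has one color, and a merge inner if it uses a pure cluster whose color has
another one. Per color, `potential` adds up the shift costs of the pure clusters to the center,
leaving out the lightest. An inner merge costs at most twice the drop of the total potential
(`mergeCost_le_potential`), which starts below OPT.

The other merges are charged by counting. Before merge `t` there are `k + (J - t)` clusters, and
`card_le_excess_add` covers the surplus `J - t` by the `excess` (pure clusters beyond the first of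
each color) and twice the number of candidate colors. The excess times `e t` is at most 2 OPT
(`excess_mul_mergeCost_le`). A candidate color bounds `e t` by a constant times the cost of itself
and its neighbors: while it is a candidate, at most three merges inside its neighborhood are not
inner, and each multiplies the local bound by at most 5 (`add_localCost_merge_le`). Finally
`sum_le_of_monotone` pays for each non-inner merge by a later inner one, by a share of the excess
bound, or by a candidate color used at most four times. -/

/-! ### Costs of clusters and of merges -/

theorem card_mul_centroid (Q : Finset ℝ) : (Q.card : ℝ) * centroid Q = ∑ x ∈ Q, x := by
  rcases Q.eq_empty_or_nonempty with rfl | h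
  · simp
  · have : (Q.card : ℝ) ≠ 0 := by exact_mod_cast h.card_pos.ne'
    unfold centroid
    field_simp

theorem costAt_eq (Q : Finset ℝ) (c : ℝ) :
    costAt Q c = cost Q + Q.card * (centroid Q - c) ^ 2 := by
  have h := card_mul_centroid Q
  have key : ∀ d : ℝ, costAt Q d = ∑ x ∈ Q, x ^ 2 - 2 * d * ∑ x ∈ Q, x + Q.card * d ^ 2 := by
    intro d
    unfold costAt
    rw [Finset.mul_sum, ← nsmul_eq_mul, ← Finset.sum_const, ← Finset.sum_sub_distrib,
      ← Finset.sum_add_distrib]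
    exact Finset.sum_congr rfl fun x _ => by ring
  unfold cost
  rw [key, key, ← h]
  ring

theorem cost_nonneg (Q : Finset ℝ) : 0 ≤ cost Q :=
  Finset.sum_nonneg fun _ _ => sq_nonneg _

theorem cost_le_costAt (Q : Finset ℝ) (c : ℝ) : cost Q ≤ costAt Q c := by
  rw [costAt_eq Q c]
  have : 0 ≤ (Q.card : ℝ) * (centroid Q - c) ^ 2 := by positivity
  linarith

theorem centroid_singleton (x : ℝ) : centroid {x} = x := by simp [centroid]

theorem cost_singleton (x : ℝ) : cost {x} = 0 := by simp [cost, costAt, centroid]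

theorem costAt_union {A B : Finset ℝ} (h : Disjoint A B) (c : ℝ) :
    costAt (A ∪ B) c = costAt A c + costAt B c :=
  Finset.sum_union h

theorem centroid_union {A B : Finset ℝ} (h : Disjoint A B) :
    centroid (A ∪ B) = (A.card * centroid A + B.card * centroid B) / (A.card + B.card) := by
  rw [card_mul_centroid, card_mul_centroid, ← Finset.sum_union h, centroid,
    Finset.card_union_of_disjoint h]
  push_cast
  rfl

theorem mergeCost_eq {A B : Finset ℝ} (h : Disjoint A B) (hA : A.Nonempty) (hB : B.Nonempty) :
    mergeCost A B =
      A.card * B.card / (A.card + B.card) * (centroid A - centroid B) ^ 2 := by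
  have ha : (0 : ℝ) < A.card := by exact_mod_cast hA.card_pos
  have hb : (0 : ℝ) < B.card := by exact_mod_cast hB.card_pos
  have h1 : cost (A ∪ B) = costAt A (centroid (A ∪ B)) + costAt B (centroid (A ∪ B)) :=
    costAt_union h _
  rw [mergeCost, h1, costAt_eq, costAt_eq, centroid_union h]
  field_simp
  ring

theorem mergeCost_comm (A B : Finset ℝ) : mergeCost A B = mergeCost B A := by
  unfold mergeCost
  rw [Finset.union_comm]
  ring

theorem mergeCost_nonneg {A B : Finset ℝ} (h : Disjoint A B) : 0 ≤ mergeCost A B := by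
  have h1 : cost (A ∪ B) = costAt A (centroid (A ∪ B)) + costAt B (centroid (A ∪ B)) :=
    costAt_union h _
  have := cost_le_costAt A (centroid (A ∪ B))
  have := cost_le_costAt B (centroid (A ∪ B))
  unfold mergeCost
  linarith

/-- The cost of moving all points of `Q` from their centroid to `c`. -/
noncomputable def shiftCost (c : ℝ) (Q : Finset ℝ) : ℝ := Q.card * (centroid Q - c) ^ 2

theorem shiftCost_nonneg (c : ℝ) (Q : Finset ℝ) : 0 ≤ shiftCost c Q := by
  unfold shiftCost
  positivity

/-- `costAt` is additive and splits into `cost` and `shiftCost`, so what a merge adds to the cost it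
takes from the shift cost. -/
theorem shiftCost_union {A B : Finset ℝ} (h : Disjoint A B) (c : ℝ) :
    shiftCost c (A ∪ B) = shiftCost c A + shiftCost c B - mergeCost A B := by
  have h1 := costAt_union h c
  rw [costAt_eq, costAt_eq A, costAt_eq B] at h1
  unfold shiftCost mergeCost
  linarith

theorem mergeCost_le_shiftCost {A B : Finset ℝ} (h : Disjoint A B) (c : ℝ) :
    mergeCost A B ≤ shiftCost c A + shiftCost c B := by
  have := shiftCost_nonneg c (A ∪ B)
  rw [shiftCost_union h] at this
  linarith

/-- Reducibility: a cheapest merge does not create cheaper merges. -/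
theorem mergeCost_le_mergeCost_union {A B C : Finset ℝ} (hAB : Disjoint A B) (hAC : Disjoint A C)
    (hBC : Disjoint B C) (hA : A.Nonempty) (hB : B.Nonempty) (hC : C.Nonempty)
    (h1 : mergeCost A B ≤ mergeCost A C) (h2 : mergeCost A B ≤ mergeCost B C) :
    mergeCost A B ≤ mergeCost (A ∪ B) C := by
  have ha : (0 : ℝ) < A.card := by exact_mod_cast hA.card_pos
  have hb : (0 : ℝ) < B.card := by exact_mod_cast hB.card_pos
  have hc : (0 : ℝ) < C.card := by exact_mod_cast hC.card_pos
  -- The Lance–Williams recurrence. Its coefficients add up to `|A| + |B| + |C|`, and the two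
  -- positive ones multiply costs of at least `D(A, B)`.
  have key : (A.card + B.card + C.card) * mergeCost (A ∪ B) C =
      (A.card + C.card) * mergeCost A C + (B.card + C.card) * mergeCost B C
        - C.card * mergeCost A B := by
    rw [mergeCost_eq (Finset.disjoint_union_left.2 ⟨hAC, hBC⟩) (hA.mono Finset.subset_union_left) hC,
      mergeCost_eq hAB hA hB, mergeCost_eq hAC hA hC, mergeCost_eq hBC hB hC,
      centroid_union hAB, Finset.card_union_of_disjoint hAB]
    push_cast
    field_simp
    ring
  have h3 : (A.card + B.card + C.card) * mergeCost A B ≤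
      (A.card + B.card + C.card) * mergeCost (A ∪ B) C := by
    rw [key]
    nlinarith
  exact le_of_mul_le_mul_left h3 (by positivity)

theorem centroid_lt_centroid {A B : Finset ℝ} (hA : A.Nonempty) (hB : B.Nonempty)
    (h : ∀ a ∈ A, ∀ b ∈ B, a < b) : centroid A < centroid B := by
  have ha : (0 : ℝ) < A.card := by exact_mod_cast hA.card_pos
  have hb : (0 : ℝ) < B.card := by exact_mod_cast hB.card_pos
  have h1 : centroid A ≤ A.max' hA := by
    unfold centroid
    rw [div_le_iff₀ ha, mul_comm, ← nsmul_eq_mul]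
    exact Finset.sum_le_card_nsmul _ _ _ fun x hx => A.le_max' x hx
  have h2 : B.min' hB ≤ centroid B := by
    unfold centroid
    rw [le_div_iff₀ hb, mul_comm, ← nsmul_eq_mul]
    exact Finset.card_nsmul_le_sum _ _ _ fun x hx => B.min'_le x hx
  exact h1.trans_lt ((h _ (A.max'_mem hA) _ (B.min'_mem hB)).trans_le h2)

/-- On the line a merge is more expensive than the cheaper merge with a cluster in between. -/
theorem not_greedy_of_between {A B C : Finset ℝ} (hA : A.Nonempty) (hB : B.Nonempty)
    (hC : C.Nonempty) (hAC : ∀ a ∈ A, ∀ c ∈ C, a < c) (hCB : ∀ c ∈ C, ∀ b ∈ B, c < b)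
    (h1 : mergeCost A B ≤ mergeCost A C) (h2 : mergeCost A B ≤ mergeCost C B) : False := by
  have dis : ∀ {X Y : Finset ℝ}, (∀ x ∈ X, ∀ y ∈ Y, x < y) → Disjoint X Y := fun h =>
    Finset.disjoint_left.2 fun x hx hy => lt_irrefl _ (h x hx x hy)
  have hAB : ∀ a ∈ A, ∀ b ∈ B, a < b := by
    obtain ⟨c, hc⟩ := hC
    exact fun a ha b hb => (hAC a ha c hc).trans (hCB c hc b hb)
  rw [mergeCost_eq (dis hAB) hA hB] at h1 h2
  rw [mergeCost_eq (dis hAC) hA hC] at h1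
  rw [mergeCost_eq (dis hCB) hC hB] at h2
  have m1 := centroid_lt_centroid hA hC hAC
  have m2 := centroid_lt_centroid hC hB hCB
  have ha : (0 : ℝ) < A.card := by exact_mod_cast hA.card_pos
  have hb : (0 : ℝ) < B.card := by exact_mod_cast hB.card_pos
  have hc : (0 : ℝ) < C.card := by exact_mod_cast hC.card_pos
  generalize (A.card : ℝ) = a at *
  generalize (B.card : ℝ) = b at *
  generalize (C.card : ℝ) = c at *
  generalize centroid A = x at *
  generalize centroid B = y at *
  generalize centroid C = z at *
  have e1 : a * c / (a + c) < a := by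
    rw [div_lt_iff₀ (by positivity)]
    nlinarith
  have e2 : c * b / (c + b) < b := by
    rw [div_lt_iff₀ (by positivity)]
    nlinarith
  have f1 : a * b / (a + b) * (x - y) ^ 2 < a * (x - z) ^ 2 :=
    h1.trans_lt (mul_lt_mul_of_pos_right e1 (by nlinarith))
  have f2 : a * b / (a + b) * (x - y) ^ 2 < b * (z - y) ^ 2 :=
    h2.trans_lt (mul_lt_mul_of_pos_right e2 (by nlinarith))
  -- The squared gaps on both sides of `z` now add up to more than `(x - y) ^ 2`, impossible for `x
  -- < z < y`.
  have g1 : b / (a + b) * (x - y) ^ 2 < (x - z) ^ 2 := by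
    have : a * (b / (a + b) * (x - y) ^ 2) < a * (x - z) ^ 2 := by
      convert f1 using 1; ring
    exact lt_of_mul_lt_mul_left this ha.le
  have g2 : a / (a + b) * (x - y) ^ 2 < (z - y) ^ 2 := by
    have : b * (a / (a + b) * (x - y) ^ 2) < b * (z - y) ^ 2 := by
      convert f2 using 1; ring
    exact lt_of_mul_lt_mul_left this hb.le
  have g3 : b / (a + b) * (x - y) ^ 2 + a / (a + b) * (x - y) ^ 2 = (x - y) ^ 2 := by
    field_simp
    ring
  nlinarith [mul_pos (sub_pos.2 m1) (sub_pos.2 m2)]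

/-! ### Interval partitions and greedy merges -/

/-- `𝒞` is a partition of `P` into nonempty sets of consecutive points. -/
structure IsIntervalPartition (P : Finset ℝ) (𝒞 : Finset (Finset ℝ)) : Prop where
  nonempty : ∀ Q ∈ 𝒞, Q.Nonempty
  disj : ∀ A ∈ 𝒞, ∀ B ∈ 𝒞, A ≠ B → Disjoint A B
  subset : ∀ Q ∈ 𝒞, Q ⊆ P
  cover : ∀ x ∈ P, ∃ Q ∈ 𝒞, x ∈ Q
  conv : ∀ Q ∈ 𝒞, ∀ x ∈ Q, ∀ z ∈ Q, ∀ y ∈ P, x ≤ y → y ≤ z → y ∈ Q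

theorem IsIntervalPartition.eq_of_mem {P : Finset ℝ} {𝒞 : Finset (Finset ℝ)}
    (h : IsIntervalPartition P 𝒞) {A B : Finset ℝ} (hA : A ∈ 𝒞) (hB : B ∈ 𝒞) {x : ℝ}
    (hxA : x ∈ A) (hxB : x ∈ B) : A = B := by
  by_contra hne
  exact Finset.disjoint_left.1 (h.disj A hA B hB hne) hxA hxB

theorem IsIntervalPartition.lt_of_lt {P : Finset ℝ} {𝒞 : Finset (Finset ℝ)}
    (h : IsIntervalPartition P 𝒞) {A B : Finset ℝ} (hA : A ∈ 𝒞) (hB : B ∈ 𝒞) (hne : A ≠ B)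
    {a b : ℝ} (ha : a ∈ A) (hb : b ∈ B) (hab : a < b) : ∀ x ∈ A, ∀ y ∈ B, x < y := by
  intro x hx y hy
  by_contra! hyx
  apply hne
  rcases le_total b x with hbx | hbx
  · exact h.eq_of_mem hA hB (h.conv A hA a ha x hx b (h.subset B hB hb) hab.le hbx) hb
  · exact h.eq_of_mem hA hB hx (h.conv B hB y hy b hb x (h.subset A hA hx) hyx hbx)

theorem isIntervalPartition_singletons (P : Finset ℝ) :
    IsIntervalPartition P (P.image fun x => {x}) where
  nonempty := by simp
  disj := by
    simp only [Finset.mem_image, forall_exists_index, and_imp]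
    rintro _ x - rfl _ y - rfl hne
    simp only [Finset.disjoint_singleton]
    rintro rfl
    exact hne rfl
  subset := by simp
  cover := fun x hx => ⟨{x}, Finset.mem_image_of_mem _ hx, by simp⟩
  conv := by
    simp only [Finset.mem_image, forall_exists_index, and_imp]
    rintro _ x - rfl u hu v hv y - h1 h2
    simp only [Finset.mem_singleton] at *
    subst hu hv
    linarith

theorem mem_merge {𝒞 : Finset (Finset ℝ)} {A B Q : Finset ℝ} :
    Q ∈ merge 𝒞 A B ↔ Q = A ∪ B ∨ (Q ∈ 𝒞 ∧ Q ≠ A ∧ Q ≠ B) := by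
  simp [merge]

section Merge

variable {P : Finset ℝ} {𝒞 : Finset (Finset ℝ)} {A B : Finset ℝ}

theorem IsGreedyMerge.disjoint (hg : IsGreedyMerge 𝒞 A B) (h : IsIntervalPartition P 𝒞) :
    Disjoint A B :=
  h.disj A hg.1 B hg.2.1 hg.2.2.1

theorem IsGreedyMerge.symm (hg : IsGreedyMerge 𝒞 A B) : IsGreedyMerge 𝒞 B A := by
  obtain ⟨hA, hB, hne, hmin⟩ := hg
  exact ⟨hB, hA, hne.symm, by rwa [mergeCost_comm]⟩

theorem IsGreedyMerge.mem_of_between (hg : IsGreedyMerge 𝒞 A B) (h : IsIntervalPartition P 𝒞)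
    {x y z : ℝ} (hx : x ∈ A) (hz : z ∈ B) (hy : y ∈ P) (hxy : x ≤ y) (hyz : y ≤ z) :
    y ∈ A ∪ B := by
  obtain ⟨hA, hB, hne, hmin⟩ := hg
  obtain ⟨C, hC, hyC⟩ := h.cover y hy
  by_contra hyn
  simp only [Finset.mem_union, not_or] at hyn
  have hCA : A ≠ C := by rintro rfl; exact hyn.1 hyC
  have hCB : C ≠ B := by rintro rfl; exact hyn.2 hyC
  have h1 : x < y := lt_of_le_of_ne hxy (by rintro rfl; exact hyn.1 hx)
  have h2 : y < z := lt_of_le_of_ne hyz (by rintro rfl; exact hyn.2 hz)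
  exact not_greedy_of_between (h.nonempty A hA) (h.nonempty B hB) (h.nonempty C hC)
    (h.lt_of_lt hA hC hCA hx hyC h1) (h.lt_of_lt hC hB hCB hyC hz h2)
    (hmin A hA C hC hCA) (hmin C hC B hB hCB)

theorem IsIntervalPartition.merge (h : IsIntervalPartition P 𝒞) (hg : IsGreedyMerge 𝒞 A B) :
    IsIntervalPartition P (merge 𝒞 A B) where
  nonempty := by
    intro Q hQ
    rcases mem_merge.1 hQ with rfl | hQ
    · exact (h.nonempty A hg.1).mono Finset.subset_union_left
    · exact h.nonempty Q hQ.1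
  disj := by
    intro X hX Y hY hne
    rcases mem_merge.1 hX with rfl | ⟨hX, hXA, hXB⟩ <;>
      rcases mem_merge.1 hY with rfl | ⟨hY, hYA, hYB⟩
    · exact absurd rfl hne
    · exact Finset.disjoint_union_left.2
        ⟨h.disj A hg.1 Y hY hYA.symm, h.disj B hg.2.1 Y hY hYB.symm⟩
    · exact Finset.disjoint_union_right.2
        ⟨h.disj X hX A hg.1 hXA, h.disj X hX B hg.2.1 hXB⟩
    · exact h.disj X hX Y hY hne
  subset := by
    intro Q hQ
    rcases mem_merge.1 hQ with rfl | hQ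
    · exact Finset.union_subset (h.subset A hg.1) (h.subset B hg.2.1)
    · exact h.subset Q hQ.1
  cover := by
    intro x hx
    obtain ⟨Q, hQ, hxQ⟩ := h.cover x hx
    by_cases hA : Q = A
    · exact ⟨A ∪ B, mem_merge.2 (Or.inl rfl), Finset.mem_union_left _ (hA ▸ hxQ)⟩
    by_cases hB : Q = B
    · exact ⟨A ∪ B, mem_merge.2 (Or.inl rfl), Finset.mem_union_right _ (hB ▸ hxQ)⟩
    exact ⟨Q, mem_merge.2 (Or.inr ⟨hQ, hA, hB⟩), hxQ⟩
  conv := by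
    intro Q hQ x hx z hz y hy hxy hyz
    rcases mem_merge.1 hQ with rfl | hQ
    · rcases Finset.mem_union.1 hx with hx | hx <;> rcases Finset.mem_union.1 hz with hz | hz
      · exact Finset.mem_union_left _ (h.conv A hg.1 x hx z hz y hy hxy hyz)
      · exact hg.mem_of_between h hx hz hy hxy hyz
      · rw [Finset.union_comm]
        exact hg.symm.mem_of_between h hx hz hy hxy hyz
      · exact Finset.mem_union_right _ (h.conv B hg.2.1 x hx z hz y hy hxy hyz)
    · exact h.conv Q hQ.1 x hx z hz y hy hxy hyz

theorem union_notMem (h : IsIntervalPartition P 𝒞) (hg : IsGreedyMerge 𝒞 A B) :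
    A ∪ B ∉ 𝒞 \ {A, B} := by
  intro hmem
  simp only [Finset.mem_sdiff, Finset.mem_insert, Finset.mem_singleton, not_or] at hmem
  obtain ⟨x, hx⟩ := h.nonempty A hg.1
  exact hmem.2.1 (h.eq_of_mem hmem.1 hg.1 (Finset.mem_union_left _ hx) hx)

theorem card_merge (h : IsIntervalPartition P 𝒞) (hg : IsGreedyMerge 𝒞 A B) :
    (merge 𝒞 A B).card + 1 = 𝒞.card := by
  have hsub : ({A, B} : Finset (Finset ℝ)) ⊆ 𝒞 := by
    simp [Finset.insert_subset_iff, hg.1, hg.2.1]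
  have h2 := Finset.card_sdiff_add_card_eq_card hsub
  rw [Finset.card_pair hg.2.2.1] at h2
  rw [merge, Finset.card_insert_of_notMem (union_notMem h hg)]
  omega

theorem sum_cost_merge (h : IsIntervalPartition P 𝒞) (hg : IsGreedyMerge 𝒞 A B) :
    ∑ Q ∈ merge 𝒞 A B, cost Q = ∑ Q ∈ 𝒞, cost Q + mergeCost A B := by
  have hsub : ({A, B} : Finset (Finset ℝ)) ⊆ 𝒞 := by
    simp [Finset.insert_subset_iff, hg.1, hg.2.1]
  rw [merge, Finset.sum_insert (union_notMem h hg), ← Finset.sum_sdiff hsub,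
    Finset.sum_pair hg.2.2.1, mergeCost]
  ring

theorem IsGreedyMerge.le_of_merge (h : IsIntervalPartition P 𝒞) (hg : IsGreedyMerge 𝒞 A B)
    {X Y : Finset ℝ} (hX : X ∈ Ward.merge 𝒞 A B) (hY : Y ∈ Ward.merge 𝒞 A B) (hne : X ≠ Y) :
    mergeCost A B ≤ mergeCost X Y := by
  have key : ∀ Y, Y ∈ 𝒞 ∧ Y ≠ A ∧ Y ≠ B → mergeCost A B ≤ mergeCost (A ∪ B) Y := by
    rintro Y ⟨hY, hYA, hYB⟩
    exact mergeCost_le_mergeCost_union (hg.disjoint h) (h.disj A hg.1 Y hY hYA.symm)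
      (h.disj B hg.2.1 Y hY hYB.symm) (h.nonempty A hg.1) (h.nonempty B hg.2.1) (h.nonempty Y hY)
      (hg.2.2.2 A hg.1 Y hY hYA.symm) (hg.2.2.2 B hg.2.1 Y hY hYB.symm)
  rcases mem_merge.1 hX with rfl | hX <;> rcases mem_merge.1 hY with rfl | hY
  · exact absurd rfl hne
  · exact key Y hY
  · rw [mergeCost_comm X]
    exact key X hX
  · exact hg.2.2.2 X hX.1 Y hY.1 hne

end Merge

/-! ### Weights without the lightest element -/

section Spread

variable {ι : Type*} [DecidableEq ι] {w : ι → ℝ} {s t : Finset ι}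

/-- The total weight of `s` without its lightest element. -/
noncomputable def spread (w : ι → ℝ) (s : Finset ι) : ℝ := ⨆ a : s, ∑ b ∈ s.erase a, w b

theorem sum_erase_le_spread (w : ι → ℝ) {a : ι} (ha : a ∈ s) :
    ∑ b ∈ s.erase a, w b ≤ spread w s :=
  le_ciSup (f := fun a : s => ∑ b ∈ s.erase a, w b) (Set.finite_range _).bddAbove ⟨a, ha⟩

/-- The supremum over an empty `s` is `0`, whence `hr`. -/
theorem spread_le {r : ℝ} (hr : 0 ≤ r) (h : ∀ a ∈ s, ∑ b ∈ s.erase a, w b ≤ r) :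
    spread w s ≤ r :=
  Real.iSup_le (fun a => h a a.2) hr

theorem spread_nonneg (hw : ∀ a, 0 ≤ w a) (s : Finset ι) : 0 ≤ spread w s :=
  Real.iSup_nonneg fun _ => Finset.sum_nonneg fun b _ => hw b

theorem spread_mono (hw : ∀ a, 0 ≤ w a) (h : s ⊆ t) : spread w s ≤ spread w t :=
  spread_le (spread_nonneg hw t) fun a ha =>
    (Finset.sum_le_sum_of_subset_of_nonneg (Finset.erase_subset_erase a h)
      fun b _ _ => hw b).trans (sum_erase_le_spread w (h ha))

theorem spread_le_sum (hw : ∀ a, 0 ≤ w a) (s : Finset ι) : spread w s ≤ ∑ a ∈ s, w a :=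
  spread_le (Finset.sum_nonneg fun b _ => hw b) fun a _ =>
    Finset.sum_le_sum_of_subset_of_nonneg (Finset.erase_subset a s) fun b _ _ => hw b

/-- For `b` lightest in `s.erase a`, the spread drops by at least `w a` and by at least `w b`. With
the plain sum as potential, removing a weightless `a` would pay for nothing. -/
theorem exists_add_le_spread_sub {a : ι} (ha : a ∈ s) (hs : 2 ≤ s.card) :
    ∃ b ∈ s, b ≠ a ∧ w a + w b ≤ 2 * (spread w s - spread w (s.erase a)) := by
  have hne : (s.erase a).Nonempty := by
    rw [← Finset.card_pos, Finset.card_erase_of_mem ha]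
    omega
  have : Nonempty (s.erase a : Finset ι) := hne.to_subtype
  obtain ⟨⟨b, hb⟩, hbe⟩ := exists_eq_ciSup_of_finite
    (f := fun b : (s.erase a : Finset ι) => ∑ x ∈ (s.erase a).erase b, w x)
  change ∑ x ∈ (s.erase a).erase b, w x = spread w (s.erase a) at hbe
  have hb' := Finset.mem_erase.1 hb
  refine ⟨b, hb'.2, hb'.1, ?_⟩
  have h1 := sum_erase_le_spread w ha
  have h2 := sum_erase_le_spread w hb'.2
  have h3 := Finset.add_sum_erase _ w hb
  have h4 := Finset.add_sum_erase (s.erase b) w (Finset.mem_erase.2 ⟨hb'.1.symm, ha⟩)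
  rw [Finset.erase_right_comm] at h4
  linarith

/-- If a remaining old element is left out, the sum falls by all of `d`. If `c` is left out, the old
sums without `a` and without `b` exceed the new one by `(w a + w b) / 2 ≥ d / 2` on average. -/
theorem spread_insert_le (hw : ∀ a, 0 ≤ w a) {a b c : ι} (ha : a ∈ s) (hb : b ∈ s) (hab : a ≠ b)
    (hc : c ∉ s \ {a, b}) {d : ℝ} (hd : 0 ≤ d) (hwc : w c = w a + w b - d) :
    d ≤ 2 * (spread w s - spread w (insert c (s \ {a, b}))) := by
  have hwc0 := hw c
  have hr : s \ {a, b} = (s.erase a).erase b := by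
    ext x
    simp only [Finset.mem_sdiff, Finset.mem_insert, Finset.mem_singleton, Finset.mem_erase]
    tauto
  have h1 := sum_erase_le_spread w ha
  have h2 := sum_erase_le_spread w hb
  have h3 := Finset.add_sum_erase (s.erase a) w (Finset.mem_erase.2 ⟨hab.symm, hb⟩)
  have h4 := Finset.add_sum_erase (s.erase b) w (Finset.mem_erase.2 ⟨hab, ha⟩)
  have h5 := Finset.add_sum_erase s w ha
  rw [Finset.erase_right_comm] at h4
  have h6 : 0 ≤ ∑ x ∈ (s.erase a).erase b, w x := Finset.sum_nonneg fun b _ => hw b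
  suffices h : spread w (insert c (s \ {a, b})) ≤ spread w s - d / 2 by linarith
  refine spread_le (by linarith) fun x hx => ?_
  have h7 := Finset.add_sum_erase _ w hx
  rw [Finset.sum_insert hc, hr] at h7
  rcases Finset.mem_insert.1 hx with rfl | hx'
  · rw [hr]
    linarith
  · have hxs := (Finset.mem_sdiff.1 hx').1
    have h8 := sum_erase_le_spread w hxs
    have h9 := Finset.add_sum_erase _ w hxs
    rw [hr]
    linarith

/-- Every element other than the lightest weighs at least `e / 2`. -/
theorem card_sub_one_mul_le_spread (hw : ∀ a, 0 ≤ w a) {e : ℝ}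
    (h : ∀ a ∈ s, ∀ b ∈ s, a ≠ b → e ≤ w a + w b) :
    ((s.card - 1 : ℕ) : ℝ) * e ≤ 2 * spread w s := by
  rcases s.eq_empty_or_nonempty with rfl | hs
  · simpa using spread_nonneg hw ∅
  obtain ⟨a, ha, hmin⟩ := s.exists_min_image w hs
  have h1 : (s.erase a).card • (e / 2) ≤ ∑ b ∈ s.erase a, w b := by
    refine Finset.card_nsmul_le_sum _ _ _ fun b hb => ?_
    obtain ⟨hba, hb⟩ := Finset.mem_erase.1 hb
    have := h a ha b hb hba.symm
    have := hmin b hb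
    linarith
  rw [Finset.card_erase_of_mem ha, nsmul_eq_mul] at h1
  have := sum_erase_le_spread w ha
  linarith

end Spread

/-! ### Pure clusters and the potential of a color -/

/-- The clusters of `𝒞` all of whose points have color `i`. -/
def pureClusters (f : ℝ → ℕ) (𝒞 : Finset (Finset ℝ)) (i : ℕ) : Finset (Finset ℝ) :=
  𝒞.filter fun Q => ∀ x ∈ Q, f x = i

/-- The potential of the clusters of color `i`. -/
noncomputable def potential (f : ℝ → ℕ) (c : ℕ → ℝ) (𝒞 : Finset (Finset ℝ)) (i : ℕ) : ℝ :=
  spread (shiftCost (c i)) (pureClusters f 𝒞 i)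

/-- The cost of the points of color `i` with the center `c i`. -/
noncomputable def colorCost (P : Finset ℝ) (f : ℝ → ℕ) (c : ℕ → ℝ) (i : ℕ) : ℝ :=
  ∑ x ∈ P with f x = i, (x - c i) ^ 2

/-- One of the merged clusters `A` and `B` has a single color that another cluster has, too. -/
def IsInnerMerge (f : ℝ → ℕ) (𝒞 : Finset (Finset ℝ)) (A B : Finset ℝ) : Prop :=
  ∃ i, (A ∈ pureClusters f 𝒞 i ∨ B ∈ pureClusters f 𝒞 i) ∧ 2 ≤ (pureClusters f 𝒞 i).card

variable {P : Finset ℝ} {𝒞 : Finset (Finset ℝ)} {A B : Finset ℝ} {f : ℝ → ℕ} {c : ℕ → ℝ} {i : ℕ}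

theorem mem_pureClusters {Q : Finset ℝ} :
    Q ∈ pureClusters f 𝒞 i ↔ Q ∈ 𝒞 ∧ ∀ x ∈ Q, f x = i :=
  Finset.mem_filter

theorem potential_nonneg (f : ℝ → ℕ) (c : ℕ → ℝ) (𝒞 : Finset (Finset ℝ)) (i : ℕ) :
    0 ≤ potential f c 𝒞 i :=
  spread_nonneg (shiftCost_nonneg _) _

theorem colorCost_nonneg (P : Finset ℝ) (f : ℝ → ℕ) (c : ℕ → ℝ) (i : ℕ) :
    0 ≤ colorCost P f c i :=
  Finset.sum_nonneg fun _ _ => sq_nonneg _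

theorem pureClusters_merge_of_mem (hA : A ∈ pureClusters f 𝒞 i) (hB : B ∈ pureClusters f 𝒞 i) :
    pureClusters f (merge 𝒞 A B) i = insert (A ∪ B) (pureClusters f 𝒞 i \ {A, B}) := by
  rw [mem_pureClusters] at hA hB
  ext Q
  simp only [mem_pureClusters, mem_merge, Finset.mem_insert, Finset.mem_sdiff,
    Finset.mem_singleton]
  constructor
  · tauto
  · rintro (rfl | h)
    · refine ⟨Or.inl rfl, fun x hx => ?_⟩
      rcases Finset.mem_union.1 hx with hx | hx
      · exact hA.2 x hx
      · exact hB.2 x hx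
    · tauto

theorem pureClusters_merge_of_not (hg : IsGreedyMerge 𝒞 A B)
    (h : ¬(A ∈ pureClusters f 𝒞 i ∧ B ∈ pureClusters f 𝒞 i)) :
    pureClusters f (merge 𝒞 A B) i = pureClusters f 𝒞 i \ {A, B} := by
  ext Q
  simp only [mem_pureClusters, mem_merge, Finset.mem_insert, Finset.mem_sdiff,
    Finset.mem_singleton]
  constructor
  · rintro ⟨rfl | hQ, hc⟩
    · exact absurd ⟨mem_pureClusters.2 ⟨hg.1, fun x hx => hc x (Finset.mem_union_left _ hx)⟩,
        mem_pureClusters.2 ⟨hg.2.1, fun x hx => hc x (Finset.mem_union_right _ hx)⟩⟩ h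
    · tauto
  · tauto

theorem mergeCost_le_potential_of_both (h : IsIntervalPartition P 𝒞) (hg : IsGreedyMerge 𝒞 A B)
    (c : ℕ → ℝ) (hA : A ∈ pureClusters f 𝒞 i) (hB : B ∈ pureClusters f 𝒞 i) :
    mergeCost A B ≤ 2 * (potential f c 𝒞 i - potential f c (merge 𝒞 A B) i) := by
  unfold potential
  rw [pureClusters_merge_of_mem hA hB]
  refine spread_insert_le (shiftCost_nonneg _) hA hB hg.2.2.1 ?_
    (mergeCost_nonneg (hg.disjoint h)) (shiftCost_union (hg.disjoint h) _)
  intro hmem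
  refine union_notMem h hg ?_
  simp only [mem_pureClusters, Finset.mem_sdiff] at hmem ⊢
  exact ⟨hmem.1.1, hmem.2⟩

theorem potential_merge_le (h : IsIntervalPartition P 𝒞) (hg : IsGreedyMerge 𝒞 A B)
    (f : ℝ → ℕ) (c : ℕ → ℝ) (i : ℕ) : potential f c (merge 𝒞 A B) i ≤ potential f c 𝒞 i := by
  by_cases hAB : A ∈ pureClusters f 𝒞 i ∧ B ∈ pureClusters f 𝒞 i
  · have := mergeCost_le_potential_of_both h hg c hAB.1 hAB.2
    have := mergeCost_nonneg (hg.disjoint h)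
    linarith
  · unfold potential
    rw [pureClusters_merge_of_not hg hAB]
    exact spread_mono (shiftCost_nonneg _) Finset.sdiff_subset

theorem mergeCost_le_shiftCost_of_mem (h : IsIntervalPartition P 𝒞) (hg : IsGreedyMerge 𝒞 A B)
    (c : ℝ) {X Y : Finset ℝ} (hX : X ∈ 𝒞) (hY : Y ∈ 𝒞) (hne : X ≠ Y) :
    mergeCost A B ≤ shiftCost c X + shiftCost c Y :=
  (hg.2.2.2 X hX Y hY hne).trans (mergeCost_le_shiftCost (h.disj X hX Y hY hne) c)

/-- If only `A` has color `i`, greediness compares the merge with that of `A` and the pure cluster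
from `exists_add_le_spread_sub`; their shift costs are paid by the removal of `A`. -/
theorem mergeCost_le_potential_of_left (h : IsIntervalPartition P 𝒞) (hg : IsGreedyMerge 𝒞 A B)
    (c : ℕ → ℝ) (hA : A ∈ pureClusters f 𝒞 i) (h2 : 2 ≤ (pureClusters f 𝒞 i).card) :
    mergeCost A B ≤ 2 * (potential f c 𝒞 i - potential f c (merge 𝒞 A B) i) := by
  by_cases hB : B ∈ pureClusters f 𝒞 i
  · exact mergeCost_le_potential_of_both h hg c hA hB
  · obtain ⟨Y, hY, hYA, hle⟩ := exists_add_le_spread_sub (w := shiftCost (c i)) hA h2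
    have h1 := mergeCost_le_shiftCost_of_mem h hg (c i) (mem_pureClusters.1 hA).1
      (mem_pureClusters.1 hY).1 hYA.symm
    unfold potential
    rw [pureClusters_merge_of_not hg fun hh => hB hh.2]
    have h3 : spread (shiftCost (c i)) (pureClusters f 𝒞 i \ {A, B}) ≤
        spread (shiftCost (c i)) ((pureClusters f 𝒞 i).erase A) := by
      refine spread_mono (shiftCost_nonneg _) fun Q hQ => ?_
      simp only [Finset.mem_sdiff, Finset.mem_insert, Finset.mem_singleton, not_or] at hQ
      exact Finset.mem_erase.2 ⟨hQ.2.1, hQ.1⟩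
    linarith

theorem merge_comm (𝒞 : Finset (Finset ℝ)) (A B : Finset ℝ) : merge 𝒞 A B = merge 𝒞 B A := by
  rw [merge, merge, Finset.union_comm, Finset.pair_comm]

theorem mergeCost_le_potential (h : IsIntervalPartition P 𝒞) (hg : IsGreedyMerge 𝒞 A B)
    (c : ℕ → ℝ) (hAB : A ∈ pureClusters f 𝒞 i ∨ B ∈ pureClusters f 𝒞 i)
    (h2 : 2 ≤ (pureClusters f 𝒞 i).card) :
    mergeCost A B ≤ 2 * (potential f c 𝒞 i - potential f c (merge 𝒞 A B) i) := by
  rcases hAB with hA | hB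
  · exact mergeCost_le_potential_of_left h hg c hA h2
  · rw [mergeCost_comm, merge_comm]
    exact mergeCost_le_potential_of_left h hg.symm c hB h2

theorem potential_singletons_le (P : Finset ℝ) (f : ℝ → ℕ) (c : ℕ → ℝ) (i : ℕ) :
    potential f c (P.image fun x => {x}) i ≤ colorCost P f c i := by
  refine (spread_le_sum (shiftCost_nonneg _) _).trans (le_of_eq ?_)
  have : pureClusters f (P.image fun x => {x}) i = {x ∈ P | f x = i}.image fun x => {x} := by
    ext Q
    simp only [mem_pureClusters, Finset.mem_image, Finset.mem_filter]
    constructor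
    · rintro ⟨⟨x, hx, rfl⟩, hc⟩
      exact ⟨x, ⟨hx, hc x (by simp)⟩, rfl⟩
    · rintro ⟨x, ⟨hx, hf⟩, rfl⟩
      exact ⟨⟨x, hx, rfl⟩, by simpa using hf⟩
  rw [this, Finset.sum_image fun x _ y _ h => Finset.singleton_injective h]
  exact Finset.sum_congr rfl fun x _ => by simp [shiftCost, centroid_singleton]

/-- The sum of the potentials pays for an inner merge among the colors in `T`. -/
theorem sum_potential_merge_le (h : IsIntervalPartition P 𝒞) (hg : IsGreedyMerge 𝒞 A B)
    (f : ℝ → ℕ) (c : ℕ → ℝ) (T : Finset ℕ) :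
    ∑ i ∈ T, potential f c (merge 𝒞 A B) i ≤ ∑ i ∈ T, potential f c 𝒞 i :=
  Finset.sum_le_sum fun i _ => potential_merge_le h hg f c i

theorem sum_potential_merge_le_sub (h : IsIntervalPartition P 𝒞) (hg : IsGreedyMerge 𝒞 A B)
    (c : ℕ → ℝ) {T : Finset ℕ} (hi : i ∈ T)
    (hAB : A ∈ pureClusters f 𝒞 i ∨ B ∈ pureClusters f 𝒞 i)
    (h2 : 2 ≤ (pureClusters f 𝒞 i).card) :
    mergeCost A B ≤
      2 * (∑ i ∈ T, potential f c 𝒞 i - ∑ i ∈ T, potential f c (merge 𝒞 A B) i) := by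
  refine (mergeCost_le_potential h hg c hAB h2).trans ?_
  rw [← Finset.sum_sub_distrib]
  have := Finset.single_le_sum (f := fun i => potential f c 𝒞 i - potential f c (merge 𝒞 A B) i)
    (fun j _ => sub_nonneg.2 (potential_merge_le h hg f c j)) hi
  linarith

/-! ### The excess of pure clusters -/

/-- The number of merges of clusters of the same color that are possible. -/
def excess (f : ℝ → ℕ) (κ : ℕ) (𝒞 : Finset (Finset ℝ)) : ℕ :=
  ∑ i ∈ Finset.range κ, ((pureClusters f 𝒞 i).card - 1)

theorem card_pureClusters_merge_le (hg : IsGreedyMerge 𝒞 A B)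
    (f : ℝ → ℕ) (i : ℕ) :
    (pureClusters f (merge 𝒞 A B) i).card ≤ (pureClusters f 𝒞 i).card := by
  by_cases hAB : A ∈ pureClusters f 𝒞 i ∧ B ∈ pureClusters f 𝒞 i
  · rw [pureClusters_merge_of_mem hAB.1 hAB.2]
    refine (Finset.card_insert_le _ _).trans ?_
    have hsub : ({A, B} : Finset (Finset ℝ)) ⊆ pureClusters f 𝒞 i := by
      simp [Finset.insert_subset_iff, hAB.1, hAB.2]
    have h2 := Finset.card_sdiff_add_card_eq_card hsub
    rw [Finset.card_pair hg.2.2.1] at h2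
    omega
  · rw [pureClusters_merge_of_not hg hAB]
    exact Finset.card_le_card Finset.sdiff_subset

theorem excess_merge_le (hg : IsGreedyMerge 𝒞 A B) (f : ℝ → ℕ) (κ : ℕ) :
    excess f κ (merge 𝒞 A B) ≤ excess f κ 𝒞 :=
  Finset.sum_le_sum fun i _ => Nat.sub_le_sub_right (card_pureClusters_merge_le hg f i) 1

/-- A merge that is not inner leaves colors with two or more pure clusters untouched; the others
contribute `0`. -/
theorem excess_le_of_not_inner (hg : IsGreedyMerge 𝒞 A B) (hin : ¬IsInnerMerge f 𝒞 A B)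
    (κ : ℕ) : excess f κ 𝒞 ≤ excess f κ (merge 𝒞 A B) := by
  refine Finset.sum_le_sum fun i _ => ?_
  by_cases h2 : 2 ≤ (pureClusters f 𝒞 i).card
  · have hn : ¬(A ∈ pureClusters f 𝒞 i ∨ B ∈ pureClusters f 𝒞 i) := fun hh => hin ⟨i, hh, h2⟩
    rw [not_or] at hn
    rw [pureClusters_merge_of_not hg fun hh => hn.1 hh.1, Finset.sdiff_eq_self_of_disjoint]
    simp [hn.1, hn.2]
  · omega

theorem pureClusters_inj (h : IsIntervalPartition P 𝒞) {Q : Finset ℝ} {i j : ℕ}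
    (hi : Q ∈ pureClusters f 𝒞 i) (hj : Q ∈ pureClusters f 𝒞 j) : i = j := by
  rw [mem_pureClusters] at hi hj
  obtain ⟨x, hx⟩ := h.nonempty Q hi.1
  rw [← hi.2 x hx, hj.2 x hx]

theorem sum_card_pureClusters_inter_le (h : IsIntervalPartition P 𝒞) (f : ℝ → ℕ)
    (s : Finset ℕ) (t : Finset (Finset ℝ)) :
    ∑ i ∈ s, (pureClusters f 𝒞 i ∩ t).card ≤ t.card := by
  rw [← Finset.card_biUnion]
  · exact Finset.card_le_card (Finset.biUnion_subset.2 fun i _ => Finset.inter_subset_right)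
  · intro i _ j _ hij
    refine Finset.disjoint_left.2 fun Q hQi hQj => hij ?_
    exact pureClusters_inj h (Finset.mem_inter.1 hQi).1 (Finset.mem_inter.1 hQj).1

/-- Only `A` and `B` disappear, and each is pure in at most one color. -/
theorem excess_le_add_two (h : IsIntervalPartition P 𝒞) (hg : IsGreedyMerge 𝒞 A B)
    (f : ℝ → ℕ) (κ : ℕ) : excess f κ 𝒞 ≤ excess f κ (merge 𝒞 A B) + 2 := by
  have h1 := sum_card_pureClusters_inter_le h f (Finset.range κ) {A, B}
  rw [Finset.card_pair hg.2.2.1] at h1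
  refine le_trans ?_ (Nat.add_le_add_left h1 _)
  rw [excess, excess, ← Finset.sum_add_distrib]
  refine Finset.sum_le_sum fun i _ => ?_
  have h2 : (pureClusters f 𝒞 i \ {A, B}).card ≤ (pureClusters f (merge 𝒞 A B) i).card := by
    by_cases hAB : A ∈ pureClusters f 𝒞 i ∧ B ∈ pureClusters f 𝒞 i
    · rw [pureClusters_merge_of_mem hAB.1 hAB.2]
      exact Finset.card_le_card (Finset.subset_insert _ _)
    · rw [pureClusters_merge_of_not hg hAB]
  have h3 := Finset.card_sdiff_add_card_inter (pureClusters f 𝒞 i) {A, B}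
  omega

theorem excess_mul_mergeCost_le (h : IsIntervalPartition P 𝒞) (hg : IsGreedyMerge 𝒞 A B)
    (f : ℝ → ℕ) (c : ℕ → ℝ) (κ : ℕ) :
    (excess f κ 𝒞 : ℝ) * mergeCost A B ≤ 2 * ∑ i ∈ Finset.range κ, potential f c 𝒞 i := by
  rw [excess, Nat.cast_sum, Finset.sum_mul, Finset.mul_sum]
  refine Finset.sum_le_sum fun i _ => ?_
  refine card_sub_one_mul_le_spread (shiftCost_nonneg _) fun X hX Y hY hne => ?_
  exact mergeCost_le_shiftCost_of_mem h hg _ (mem_pureClusters.1 hX).1 (mem_pureClusters.1 hY).1 hne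

/-! ### Interval colorings and the cost around a candidate color -/

/-- A coloring of the points of `P` with the colors `0, …, κ - 1`, all of which occur, whose
color classes consist of consecutive points. -/
structure IsIntervalColoring (P : Finset ℝ) (κ : ℕ) (f : ℝ → ℕ) : Prop where
  lt : ∀ x ∈ P, f x < κ
  surj : ∀ i < κ, ∃ x ∈ P, f x = i
  mono : ∀ x ∈ P, ∀ y ∈ P, x ≤ y → f x ≤ f y

theorem IsIntervalColoring.lt_of_color_lt {P : Finset ℝ} {κ : ℕ} {f : ℝ → ℕ}
    (hf : IsIntervalColoring P κ f) {x y : ℝ} (hx : x ∈ P) (hy : y ∈ P) (h : f x < f y) :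
    x < y := by
  by_contra! hle
  exact absurd (hf.mono y hy x hx hle) (not_le.2 h)

/-- All colors of `Q` are in `T`. -/
def IsInside (f : ℝ → ℕ) (T : Finset ℕ) (Q : Finset ℝ) : Prop := ∀ x ∈ Q, f x ∈ T

instance (f : ℝ → ℕ) (T : Finset ℕ) : DecidablePred (IsInside f T) := fun Q =>
  inferInstanceAs (Decidable (∀ x ∈ Q, f x ∈ T))

/-- At least half of the points of `Q` have color `i`. -/
def IsMajority (f : ℝ → ℕ) (i : ℕ) (Q : Finset ℝ) : Prop :=
  Q.card ≤ 2 * {x ∈ Q | f x = i}.card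

/-- The color `i` and its neighbors. -/
def near (i : ℕ) : Finset ℕ := Finset.Icc (i - 1) (i + 1)

/-- Most points of `Q` have color `i`, the others have neighboring colors. -/
def IsCentered (f : ℝ → ℕ) (i : ℕ) (Q : Finset ℝ) : Prop :=
  IsMajority f i Q ∧ IsInside f (near i) Q

/-- Two clusters of `𝒞` are centered at the color `i`. -/
def IsCandidate (f : ℝ → ℕ) (𝒞 : Finset (Finset ℝ)) (i : ℕ) : Prop :=
  ∃ X ∈ 𝒞, ∃ Y ∈ 𝒞, X ≠ Y ∧ IsCentered f i X ∧ IsCentered f i Y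

/-- The cost of the clusters with colors in `T` together with the potential of `T`. -/
noncomputable def localCost (f : ℝ → ℕ) (c : ℕ → ℝ) (T : Finset ℕ) (𝒞 : Finset (Finset ℝ)) : ℝ :=
  ∑ Q ∈ 𝒞 with IsInside f T Q, cost Q + 2 * ∑ i ∈ T, potential f c 𝒞 i

/-- The number of colors in `T` that have a cluster of their own. -/
def numPure (f : ℝ → ℕ) (T : Finset ℕ) (𝒞 : Finset (Finset ℝ)) : ℕ :=
  {i ∈ T | (pureClusters f 𝒞 i).Nonempty}.card

variable {κ : ℕ}

theorem isInside_union {T : Finset ℕ} :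
    IsInside f T (A ∪ B) ↔ IsInside f T A ∧ IsInside f T B := by
  simp only [IsInside, Finset.mem_union, or_imp, forall_and]

theorem sum_inside_merge (h : IsIntervalPartition P 𝒞) (hg : IsGreedyMerge 𝒞 A B) (f : ℝ → ℕ)
    (T : Finset ℕ) :
    ∑ Q ∈ merge 𝒞 A B with IsInside f T Q, cost Q ≤ ∑ Q ∈ 𝒞 with IsInside f T Q, cost Q +
      if IsInside f T (A ∪ B) then mergeCost A B else 0 := by
  have hsub : ({A, B} : Finset (Finset ℝ)) ⊆ 𝒞 := by
    simp [Finset.insert_subset_iff, hg.1, hg.2.1]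
  rw [Finset.sum_filter, Finset.sum_filter, merge, Finset.sum_insert (union_notMem h hg),
    ← Finset.sum_sdiff hsub, Finset.sum_pair hg.2.2.1]
  split_ifs with h1 h2 h3 h3 h2 h3 h3
  all_goals first
    | (unfold mergeCost; linarith)
    | exact absurd (isInside_union.1 h1) (by tauto)
    | linarith [cost_nonneg A, cost_nonneg B]

theorem localCost_merge_le (h : IsIntervalPartition P 𝒞) (hg : IsGreedyMerge 𝒞 A B) (f : ℝ → ℕ)
    (c : ℕ → ℝ) (T : Finset ℕ) :
    localCost f c T (merge 𝒞 A B) ≤ localCost f c T 𝒞 + mergeCost A B := by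
  have h1 := sum_inside_merge h hg f T
  have h2 := sum_potential_merge_le h hg f c T
  have h3 := mergeCost_nonneg (hg.disjoint h)
  unfold localCost
  split_ifs at h1 <;> linarith

/-- An inner merge inside `T` is paid by the potentials of `T`; a merge that is not inside `T` adds
no cluster to the sum. -/
theorem localCost_merge_le_self (h : IsIntervalPartition P 𝒞) (hg : IsGreedyMerge 𝒞 A B)
    (c : ℕ → ℝ) {T : Finset ℕ} (hT : IsInside f T (A ∪ B) → IsInnerMerge f 𝒞 A B) :
    localCost f c T (merge 𝒞 A B) ≤ localCost f c T 𝒞 := by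
  have h1 := sum_inside_merge h hg f T
  unfold localCost
  split_ifs at h1 with hin
  · obtain ⟨i, hAB, h2⟩ := hT hin
    have hi : i ∈ T := by
      rcases hAB with hA | hB
      · obtain ⟨x, hx⟩ := h.nonempty A hg.1
        rw [← (mem_pureClusters.1 hA).2 x hx]
        exact hin x (Finset.mem_union_left _ hx)
      · obtain ⟨x, hx⟩ := h.nonempty B hg.2.1
        rw [← (mem_pureClusters.1 hB).2 x hx]
        exact hin x (Finset.mem_union_right _ hx)
    have := sum_potential_merge_le_sub h hg c hi hAB h2
    linarith
  · have h2 := sum_potential_merge_le h hg f c T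
    linarith

theorem localCost_singletons_le (P : Finset ℝ) (f : ℝ → ℕ) (c : ℕ → ℝ) (T : Finset ℕ) :
    localCost f c T (P.image fun x => {x}) ≤ 2 * ∑ i ∈ T, colorCost P f c i := by
  have h1 : ∑ Q ∈ P.image (fun x => ({x} : Finset ℝ)) with IsInside f T Q, cost Q = 0 := by
    refine Finset.sum_eq_zero fun Q hQ => ?_
    obtain ⟨x, -, rfl⟩ := Finset.mem_image.1 (Finset.mem_filter.1 hQ).1
    exact cost_singleton x
  have h2 : ∑ i ∈ T, potential f c (P.image fun x => {x}) i ≤ ∑ i ∈ T, colorCost P f c i :=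
    Finset.sum_le_sum fun i _ => potential_singletons_le P f c i
  unfold localCost
  linarith

/-- Each point `x` of color `i` gives `(μ - c)² ≤ 2 (x - μ)² + 2 (x - c)²`, and these points are at
least half of `Q`. -/
theorem shiftCost_le_of_isMajority {Q : Finset ℝ} (hQ : IsMajority f i Q) (c : ℝ) :
    shiftCost c Q ≤ 4 * cost Q + 4 * ∑ x ∈ Q with f x = i, (x - c) ^ 2 := by
  have h1 : (Q.card : ℝ) ≤ 2 * ({x ∈ Q | f x = i}.card : ℝ) := by exact_mod_cast hQ
  have h2 : ({x ∈ Q | f x = i}.card : ℝ) * (centroid Q - c) ^ 2 ≤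
      ∑ x ∈ Q with f x = i, (2 * (x - centroid Q) ^ 2 + 2 * (x - c) ^ 2) := by
    rw [← nsmul_eq_mul]
    refine Finset.card_nsmul_le_sum _ _ _ fun x _ => ?_
    nlinarith [sq_nonneg ((x - centroid Q) + (x - c))]
  rw [Finset.sum_add_distrib, ← Finset.mul_sum, ← Finset.mul_sum] at h2
  have h3 : ∑ x ∈ Q with f x = i, (x - centroid Q) ^ 2 ≤ cost Q :=
    Finset.sum_le_sum_of_subset_of_nonneg (Finset.filter_subset _ _) fun _ _ _ => sq_nonneg _
  have h4 := mul_le_mul_of_nonneg_right h1 (sq_nonneg (centroid Q - c))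
  unfold shiftCost
  linarith

theorem self_mem_near (i : ℕ) : i ∈ near i := by
  simp only [near, Finset.mem_Icc]
  omega

/-- The greedy merge is no dearer than that of the two centered clusters, whose own costs are part
of `localCost`. -/
theorem mergeCost_le_of_isCandidate (h : IsIntervalPartition P 𝒞) (hg : IsGreedyMerge 𝒞 A B)
    (c : ℕ → ℝ) (hi : IsCandidate f 𝒞 i) :
    mergeCost A B ≤
      4 * (∑ j ∈ near i, colorCost P f c j + localCost f c (near i) 𝒞) := by
  obtain ⟨X, hX, Y, hY, hne, ⟨hXm, hXi⟩, hYm, hYi⟩ := hi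
  have hd := h.disj X hX Y hY hne
  have h1 := mergeCost_le_shiftCost_of_mem h hg (c i) hX hY hne
  have h2 := shiftCost_le_of_isMajority hXm (c i)
  have h3 := shiftCost_le_of_isMajority hYm (c i)
  have h4 : ∑ x ∈ X with f x = i, (x - c i) ^ 2 + ∑ x ∈ Y with f x = i, (x - c i) ^ 2 ≤
      colorCost P f c i := by
    rw [← Finset.sum_union (Finset.disjoint_filter_filter hd), ← Finset.filter_union]
    exact Finset.sum_le_sum_of_subset_of_nonneg (Finset.filter_subset_filter _
      (Finset.union_subset (h.subset X hX) (h.subset Y hY))) fun _ _ _ => sq_nonneg _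
  have h5 : colorCost P f c i ≤ ∑ j ∈ near i, colorCost P f c j :=
    Finset.single_le_sum (fun j _ => colorCost_nonneg P f c j) (self_mem_near i)
  have h6 : cost X + cost Y ≤ ∑ Q ∈ 𝒞 with IsInside f (near i) Q, cost Q := by
    rw [← Finset.sum_pair hne]
    refine Finset.sum_le_sum_of_subset_of_nonneg ?_ fun Q _ _ => cost_nonneg Q
    simp [Finset.insert_subset_iff, hX, hY, hXi, hYi]
  have h7 : 0 ≤ ∑ j ∈ near i, potential f c 𝒞 j :=
    Finset.sum_nonneg fun j _ => potential_nonneg f c 𝒞 j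
  unfold localCost
  linarith

theorem isMajority_of_union (h : Disjoint A B) (hm : IsMajority f i (A ∪ B)) :
    IsMajority f i A ∨ IsMajority f i B := by
  unfold IsMajority at *
  rw [Finset.filter_union, Finset.card_union_of_disjoint h,
    Finset.card_union_of_disjoint (Finset.disjoint_filter_filter h)] at hm
  omega

theorem IsMajority.exists_mem {Q : Finset ℝ} (hm : IsMajority f i Q) (hQ : Q.Nonempty) :
    ∃ x ∈ Q, f x = i := by
  have h1 := hQ.card_pos
  unfold IsMajority at hm
  obtain ⟨x, hx⟩ := Finset.card_pos.1 (show 0 < {x ∈ Q | f x = i}.card by omega)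
  exact ⟨x, Finset.mem_filter.1 hx⟩

theorem exists_isCentered_of_merge (h : IsIntervalPartition P 𝒞) (hg : IsGreedyMerge 𝒞 A B)
    {Q : Finset ℝ} (hQ : Q ∈ merge 𝒞 A B) (hc : IsCentered f i Q) :
    ∃ R ∈ 𝒞, R ⊆ Q ∧ IsCentered f i R := by
  rcases mem_merge.1 hQ with rfl | hQ
  · obtain ⟨hm, hin⟩ := hc
    rw [isInside_union] at hin
    rcases isMajority_of_union (hg.disjoint h) hm with hA | hB
    · exact ⟨A, hg.1, Finset.subset_union_left, hA, hin.1⟩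
    · exact ⟨B, hg.2.1, Finset.subset_union_right, hB, hin.2⟩
  · exact ⟨Q, hQ.1, subset_rfl, hc⟩

/-- One part of a centered union is centered. So a candidate was a candidate at all earlier times,
and its local bound can be proved by induction on time. -/
theorem IsCandidate.of_merge (h : IsIntervalPartition P 𝒞) (hg : IsGreedyMerge 𝒞 A B)
    (hi : IsCandidate f (merge 𝒞 A B) i) : IsCandidate f 𝒞 i := by
  obtain ⟨X, hX, Y, hY, hne, hXc, hYc⟩ := hi
  obtain ⟨X', hX', hXs, hXc'⟩ := exists_isCentered_of_merge h hg hX hXc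
  obtain ⟨Y', hY', hYs, hYc'⟩ := exists_isCentered_of_merge h hg hY hYc
  refine ⟨X', hX', Y', hY', ?_, hXc', hYc'⟩
  rintro rfl
  obtain ⟨x, hx⟩ := h.nonempty X' hX'
  exact hne ((h.merge hg).eq_of_mem hX hY (hXs hx) (hYs hx))

theorem numPure_merge_le (hg : IsGreedyMerge 𝒞 A B) (f : ℝ → ℕ) (T : Finset ℕ) :
    numPure f T (merge 𝒞 A B) ≤ numPure f T 𝒞 := by
  refine Finset.card_le_card fun i hi => ?_
  rw [Finset.mem_filter, ← Finset.card_pos] at hi ⊢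
  exact ⟨hi.1, hi.2.trans_le (card_pureClusters_merge_le hg f i)⟩

/-- The merged pure cluster is the only one of its color, since otherwise the merge would be inner.
-/
theorem numPure_merge_lt (hg : IsGreedyMerge 𝒞 A B) {T : Finset ℕ} (hi : i ∈ T) (hAB : A ∈ pureClusters f 𝒞 i ∨ B ∈ pureClusters f 𝒞 i)
    (hin : ¬IsInnerMerge f 𝒞 A B) : numPure f T (merge 𝒞 A B) < numPure f T 𝒞 := by
  have h1 : (pureClusters f 𝒞 i).card ≤ 1 := by
    by_contra! h2
    exact hin ⟨i, hAB, h2⟩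
  have hboth : ¬(A ∈ pureClusters f 𝒞 i ∧ B ∈ pureClusters f 𝒞 i) := fun hh =>
    hg.2.2.1 (Finset.card_le_one.1 h1 A hh.1 B hh.2)
  have h2 : pureClusters f (merge 𝒞 A B) i = ∅ := by
    rw [pureClusters_merge_of_not hg hboth, Finset.sdiff_eq_empty_iff_subset]
    intro Q hQ
    rw [Finset.mem_insert, Finset.mem_singleton]
    rcases hAB with hA | hB
    · exact Or.inl (Finset.card_le_one.1 h1 Q hQ A hA)
    · exact Or.inr (Finset.card_le_one.1 h1 Q hQ B hB)
  refine Finset.card_lt_card ⟨fun j hj => ?_, fun hsub => ?_⟩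
  · rw [Finset.mem_filter, ← Finset.card_pos] at hj ⊢
    exact ⟨hj.1, hj.2.trans_le (card_pureClusters_merge_le hg f j)⟩
  · have hmem : i ∈ {i ∈ T | (pureClusters f 𝒞 i).Nonempty} :=
      Finset.mem_filter.2 ⟨hi, hAB.elim (fun hA => ⟨A, hA⟩) fun hB => ⟨B, hB⟩⟩
    have := (Finset.mem_filter.1 (hsub hmem)).2
    rw [h2] at this
    exact Finset.not_nonempty_empty this

/-- Two different clusters do not cross the same color boundary. -/
theorem eq_of_colors_cross (h : IsIntervalPartition P 𝒞) (hf : IsIntervalColoring P κ f)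
    (hA : A ∈ 𝒞) (hB : B ∈ 𝒞) {a a' b b' : ℝ} (ha : a ∈ A) (ha' : a' ∈ A) (hb : b ∈ B)
    (hb' : b' ∈ B) (h1 : f a < f b') (h2 : f b < f a') : A = B := by
  by_contra hne
  have m1 := hf.lt_of_color_lt (h.subset A hA ha) (h.subset B hB hb') h1
  have m2 := hf.lt_of_color_lt (h.subset B hB hb) (h.subset A hA ha') h2
  exact lt_asymm m2 (h.lt_of_lt hA hB hne ha hb' m1 a' ha' b hb)

theorem exists_color_lt {Q : Finset ℝ} (hQ : ∀ i, ¬∀ x ∈ Q, f x = i) (hne : Q.Nonempty) :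
    ∃ x ∈ Q, ∃ y ∈ Q, f x < f y := by
  obtain ⟨x, hx⟩ := hne
  have := hQ (f x)
  push Not at this
  obtain ⟨y, hy, hxy⟩ := this
  rcases lt_or_gt_of_ne hxy with h | h
  · exact ⟨y, hy, x, hx, h⟩
  · exact ⟨x, hx, y, hy, h⟩

/-- If two clusters with several colors near `i` are merged, they swallow the color `i`. -/
theorem not_isCandidate_merge (h : IsIntervalPartition P 𝒞) (hf : IsIntervalColoring P κ f)
    (hg : IsGreedyMerge 𝒞 A B) (hA : ∀ j, A ∉ pureClusters f 𝒞 j)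
    (hB : ∀ j, B ∉ pureClusters f 𝒞 j) (hin : IsInside f (near i) (A ∪ B)) :
    ¬IsCandidate f (merge 𝒞 A B) i := by
  rintro ⟨X, hX, Y, hY, hne, hXc, hYc⟩
  have h' := h.merge hg
  obtain ⟨x, hx, hxi⟩ := hXc.1.exists_mem (h'.nonempty X hX)
  obtain ⟨y, hy, hyi⟩ := hYc.1.exists_mem (h'.nonempty Y hY)
  obtain ⟨a, ha, a', ha', haa⟩ := exists_color_lt
    (fun j hj => hA j (mem_pureClusters.2 ⟨hg.1, hj⟩)) (h.nonempty A hg.1)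
  obtain ⟨b, hb, b', hb', hbb⟩ := exists_color_lt
    (fun j hj => hB j (mem_pureClusters.2 ⟨hg.2.1, hj⟩)) (h.nonempty B hg.2.1)
  have n1 := eq_of_colors_cross h hf hg.1 hg.2.1 ha ha' hb hb'
  have hmem : A ∪ B ∈ merge 𝒞 A B := mem_merge.2 (Or.inl rfl)
  have i1 := hin a (Finset.mem_union_left _ ha)
  have i2 := hin a' (Finset.mem_union_left _ ha')
  have i3 := hin b (Finset.mem_union_right _ hb)
  have i4 := hin b' (Finset.mem_union_right _ hb')
  simp only [near, Finset.mem_Icc] at i1 i2 i3 i4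
  -- `A` and `B` each cross a boundary of the color `i`, but not the same one, so the union has
  -- colors on both sides of `i`. For `i = 0` there is only one boundary and the case is
  -- contradictory.
  have key : ∃ u ∈ A ∪ B, ∃ v ∈ A ∪ B, f u < i ∧ i < f v := by
    by_cases hc : f a < f b'
    · have hc2 : f a' ≤ f b := by
        by_contra! hlt
        exact hg.2.2.1 (n1 hc hlt)
      exact ⟨a, Finset.mem_union_left _ ha, b', Finset.mem_union_right _ hb', by omega, by omega⟩
    · exact ⟨b, Finset.mem_union_right _ hb, a', Finset.mem_union_left _ ha', by omega, by omega⟩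
  obtain ⟨u, hu, v, hv, hui, hiv⟩ := key
  have hall : ∀ z ∈ P, f z = i → z ∈ A ∪ B := fun z hz hzi =>
    h'.conv _ hmem u hu v hv z hz
      (hf.lt_of_color_lt (h'.subset _ hmem hu) hz (by omega)).le
      (hf.lt_of_color_lt hz (h'.subset _ hmem hv) (by omega)).le
  exact hne ((h'.eq_of_mem hX hmem hx (hall x (h'.subset X hX hx) hxi)).trans
    (h'.eq_of_mem hmem hY (hall y (h'.subset Y hY hy) hyi) hy))

/-- The induction step for the bound on the local cost around a color with two clusters. -/
theorem add_localCost_merge_le (h : IsIntervalPartition P 𝒞) (hf : IsIntervalColoring P κ f)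
    (hg : IsGreedyMerge 𝒞 A B) (c : ℕ → ℝ) (hi : IsCandidate f (merge 𝒞 A B) i) {b : ℝ}
    (hb : ∑ j ∈ near i, colorCost P f c j = b) {r : ℝ}
    (hle : 5 ^ numPure f (near i) 𝒞 * (b + localCost f c (near i) 𝒞) ≤ r) :
    5 ^ numPure f (near i) (merge 𝒞 A B) * (b + localCost f c (near i) (merge 𝒞 A B)) ≤ r := by
  have hb0 : 0 ≤ b := hb ▸ Finset.sum_nonneg fun j _ => colorCost_nonneg P f c j
  have hL : ∀ 𝒟, 0 ≤ localCost f c (near i) 𝒟 := fun 𝒟 =>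
    add_nonneg (Finset.sum_nonneg fun Q _ => cost_nonneg Q)
      (mul_nonneg two_pos.le (Finset.sum_nonneg fun j _ => potential_nonneg f c 𝒟 j))
  refine le_trans ?_ hle
  by_cases hbad : IsInside f (near i) (A ∪ B) ∧ ¬IsInnerMerge f 𝒞 A B
  · obtain ⟨hin, hni⟩ := hbad
    have hpure : ∃ j ∈ near i, A ∈ pureClusters f 𝒞 j ∨ B ∈ pureClusters f 𝒞 j := by
      by_contra! hcon
      refine not_isCandidate_merge h hf hg (fun j hj => ?_) (fun j hj => ?_) hin hi
      · obtain ⟨x, hx⟩ := h.nonempty A hg.1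
        refine (hcon j ?_).1 hj
        rw [← (mem_pureClusters.1 hj).2 x hx]
        exact hin x (Finset.mem_union_left _ hx)
      · obtain ⟨x, hx⟩ := h.nonempty B hg.2.1
        refine (hcon j ?_).2 hj
        rw [← (mem_pureClusters.1 hj).2 x hx]
        exact hin x (Finset.mem_union_right _ hx)
    obtain ⟨j, hj, hAB⟩ := hpure
    have h1 := numPure_merge_lt hg hj hAB hni
    have h2 := localCost_merge_le h hg f c (near i)
    -- The merge adds at most four times `b + localCost`. The resulting factor `5 = 1 + 4` is offset
    -- by the color lost from `numPure`.
    have h3 := mergeCost_le_of_isCandidate h hg c (hi.of_merge h hg)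
    rw [hb] at h3
    calc (5 : ℝ) ^ numPure f (near i) (merge 𝒞 A B) *
          (b + localCost f c (near i) (merge 𝒞 A B))
        ≤ 5 ^ numPure f (near i) (merge 𝒞 A B) * (5 * (b + localCost f c (near i) 𝒞)) := by
          gcongr
          linarith
      _ = 5 ^ (numPure f (near i) (merge 𝒞 A B) + 1) * (b + localCost f c (near i) 𝒞) := by ring
      _ ≤ 5 ^ numPure f (near i) 𝒞 * (b + localCost f c (near i) 𝒞) := by
          have := hL 𝒞
          gcongr
          · norm_num
          · exact h1
  · have h1 := numPure_merge_le hg f (near i)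
    have h2 : localCost f c (near i) (merge 𝒞 A B) ≤ localCost f c (near i) 𝒞 :=
      localCost_merge_le_self h hg c fun hin => by
        by_contra hni
        exact hbad ⟨hin, hni⟩
    have := hL (merge 𝒞 A B)
    gcongr
    norm_num

/-! ### Counting clusters by colors -/

/-- The clusters with several colors. -/
noncomputable def mixedClusters (f : ℝ → ℕ) (κ : ℕ) (𝒞 : Finset (Finset ℝ)) : Finset (Finset ℝ) :=
  𝒞 \ (Finset.range κ).biUnion (pureClusters f 𝒞)

theorem not_pure_of_mem_mixedClusters (h : IsIntervalPartition P 𝒞)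
    (hf : IsIntervalColoring P κ f) {Q : Finset ℝ} (hQ : Q ∈ mixedClusters f κ 𝒞) (i : ℕ) :
    ¬∀ x ∈ Q, f x = i := by
  intro hi
  simp only [mixedClusters, Finset.mem_sdiff, Finset.mem_biUnion, Finset.mem_range,
    not_exists, not_and] at hQ
  obtain ⟨x, hx⟩ := h.nonempty Q hQ.1
  exact hQ.2 i (hi x hx ▸ hf.lt x (h.subset Q hQ.1 hx)) (mem_pureClusters.2 ⟨hQ.1, hi⟩)

/-- A cluster belongs to the color `i` if it contains all points of color `i` or is centered
at `i`. -/
def BelongsTo (P : Finset ℝ) (f : ℝ → ℕ) (Q : Finset ℝ) (i : ℕ) : Prop :=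
  (∀ x ∈ P, f x = i → x ∈ Q) ∨ IsCentered f i Q

/-- A cluster that reaches beyond the color after its first contains all of that next color.
Otherwise it has at most two colors, adjacent ones, and one of them makes up at least half. -/
theorem exists_belongsTo (h : IsIntervalPartition P 𝒞) (hf : IsIntervalColoring P κ f)
    {Q : Finset ℝ} (hQ : Q ∈ 𝒞) : ∃ i < κ, BelongsTo P f Q i := by
  have hne := h.nonempty Q hQ
  have hx := Q.min'_mem hne
  have hz := Q.max'_mem hne
  set x := Q.min' hne
  set z := Q.max' hne
  have hxP := h.subset Q hQ hx
  have hzP := h.subset Q hQ hz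
  have hlo : ∀ y ∈ Q, f x ≤ f y := fun y hy =>
    hf.mono x hxP y (h.subset Q hQ hy) (Q.min'_le y hy)
  have hhi : ∀ y ∈ Q, f y ≤ f z := fun y hy =>
    hf.mono y (h.subset Q hQ hy) z hzP (Q.le_max' y hy)
  by_cases hfull : f x + 1 < f z
  · refine ⟨f x + 1, hfull.trans (hf.lt z hzP), Or.inl fun y hy hyi => ?_⟩
    exact h.conv Q hQ x hx z hz y hy (hf.lt_of_color_lt hxP hy (by omega)).le
      (hf.lt_of_color_lt hy hzP (by omega)).le
  · have hcard := Finset.card_filter_add_card_filter_not (s := Q) (fun y => f y = f x)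
    have hsub : {y ∈ Q | ¬f y = f x} ⊆ {y ∈ Q | f y = f z} := by
      intro y hy
      rw [Finset.mem_filter] at hy ⊢
      have := hlo y hy.1
      have := hhi y hy.1
      exact ⟨hy.1, by omega⟩
    have hle := Finset.card_le_card hsub
    by_cases hm : IsMajority f (f x) Q
    · refine ⟨f x, hf.lt x hxP, Or.inr ⟨hm, fun y hy => ?_⟩⟩
      have := hlo y hy
      have := hhi y hy
      simp only [near, Finset.mem_Icc]
      omega
    · refine ⟨f z, hf.lt z hzP, Or.inr ⟨?_, fun y hy => ?_⟩⟩
      · unfold IsMajority at hm ⊢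
        omega
      · have := hlo y hy
        have := hhi y hy
        simp only [near, Finset.mem_Icc]
        omega

theorem BelongsTo.exists_mem (h : IsIntervalPartition P 𝒞) (hf : IsIntervalColoring P κ f)
    {Q : Finset ℝ} (hQ : Q ∈ 𝒞) (hi : i < κ) (hb : BelongsTo P f Q i) : ∃ x ∈ Q, f x = i := by
  rcases hb with hb | hb
  · obtain ⟨x, hx, hxi⟩ := hf.surj i hi
    exact ⟨x, hb x hx hxi, hxi⟩
  · exact hb.1.exists_mem (h.nonempty Q hQ)

theorem BelongsTo.isCentered (h : IsIntervalPartition P 𝒞) {Q R : Finset ℝ} (hQ : Q ∈ 𝒞)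
    (hR : R ∈ 𝒞) (hne : Q ≠ R) (hb : BelongsTo P f Q i) (hx : ∃ x ∈ R, f x = i) :
    IsCentered f i Q := by
  refine hb.resolve_left fun hall => ?_
  obtain ⟨x, hx, hxi⟩ := hx
  exact hne (h.eq_of_mem hQ hR (hall x (h.subset R hR hx) hxi) hx)

theorem isCentered_of_pure {Q : Finset ℝ} (hQ : ∀ x ∈ Q, f x = i) : IsCentered f i Q := by
  refine ⟨?_, fun x hx => hQ x hx ▸ self_mem_near _⟩
  rw [IsMajority, Finset.filter_true_of_mem hQ]
  omega

theorem card_filter_mem_le_one (h : IsIntervalPartition P 𝒞) {𝒟 : Finset (Finset ℝ)}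
    (hs : 𝒟 ⊆ 𝒞) (x : ℝ) : {Q ∈ 𝒟 | x ∈ Q}.card ≤ 1 := by
  refine Finset.card_le_one.2 fun A hA B hB => ?_
  rw [Finset.mem_filter] at hA hB
  exact h.eq_of_mem (hs hA.1) (hs hB.1) hA.2 hB.2

/-- A cluster that meets a color class and leaves it contains the first or the last point of the
class. -/
theorem card_mixed_touching_le_two (h : IsIntervalPartition P 𝒞)
    (hf : IsIntervalColoring P κ f) (hi : i < κ) {𝒟 : Finset (Finset ℝ)} (hs : 𝒟 ⊆ 𝒞)
    (hmix : ∀ Q ∈ 𝒟, ¬∀ x ∈ Q, f x = i) (ht : ∀ Q ∈ 𝒟, ∃ x ∈ Q, f x = i) : 𝒟.card ≤ 2 := by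
  have hne : {x ∈ P | f x = i}.Nonempty := by
    obtain ⟨x, hx, hxi⟩ := hf.surj i hi
    exact ⟨x, Finset.mem_filter.2 ⟨hx, hxi⟩⟩
  have hlo := Finset.min'_mem _ hne
  have hhi := Finset.max'_mem _ hne
  set lo := Finset.min' _ hne
  set hi' := Finset.max' _ hne
  have hmin : ∀ y ∈ P, f y = i → lo ≤ y := fun y hy hyi =>
    Finset.min'_le _ y (Finset.mem_filter.2 ⟨hy, hyi⟩)
  have hmax : ∀ y ∈ P, f y = i → y ≤ hi' := fun y hy hyi =>
    Finset.le_max' _ y (Finset.mem_filter.2 ⟨hy, hyi⟩)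
  rw [Finset.mem_filter] at hlo hhi
  have hsub : 𝒟 ⊆ {Q ∈ 𝒟 | lo ∈ Q} ∪ {Q ∈ 𝒟 | hi' ∈ Q} := by
    intro Q hQ
    have hQ𝒞 := hs hQ
    obtain ⟨x, hx, hxi⟩ := ht Q hQ
    have hy := hmix Q hQ
    push Not at hy
    obtain ⟨y, hy, hyi⟩ := hy
    have hxP := h.subset Q hQ𝒞 hx
    have hyP := h.subset Q hQ𝒞 hy
    rw [Finset.mem_union, Finset.mem_filter, Finset.mem_filter]
    rcases lt_or_gt_of_ne hyi with hlt | hgt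
    · exact Or.inl ⟨hQ, h.conv Q hQ𝒞 y hy x hx lo hlo.1
        (hf.lt_of_color_lt hyP hlo.1 (by omega)).le (hmin x hxP hxi)⟩
    · exact Or.inr ⟨hQ, h.conv Q hQ𝒞 x hx y hy hi' hhi.1 (hmax x hxP hxi)
        (hf.lt_of_color_lt hhi.1 hyP (by omega)).le⟩
  have h1 := Finset.card_le_card hsub
  have h2 := Finset.card_union_le {Q ∈ 𝒟 | lo ∈ Q} {Q ∈ 𝒟 | hi' ∈ Q}
  have h3 := card_filter_mem_le_one h hs lo
  have h4 := card_filter_mem_le_one h hs hi'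
  omega

open Classical in
/-- If there are many clusters but few possible merges within a color, there are many
candidates. -/
theorem card_le_excess_add (h : IsIntervalPartition P 𝒞) (hf : IsIntervalColoring P κ f) :
    𝒞.card ≤ excess f κ 𝒞 + κ + 2 * {i ∈ Finset.range κ | IsCandidate f 𝒞 i}.card := by
  have hsub : mixedClusters f κ 𝒞 ⊆ 𝒞 := Finset.sdiff_subset
  have hex : ∀ Q ∈ mixedClusters f κ 𝒞, ∃ i < κ, BelongsTo P f Q i := fun Q hQ =>
    exists_belongsTo h hf (hsub hQ)
  choose! home hlt hhome using hex
  have h1 : 𝒞.card ≤ (mixedClusters f κ 𝒞).card +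
      ∑ i ∈ Finset.range κ, (pureClusters f 𝒞 i).card :=
    (Finset.card_le_card_sdiff_add_card (s := 𝒞) (t := (Finset.range κ).biUnion (pureClusters f 𝒞))).trans
      (Nat.add_le_add_left Finset.card_biUnion_le _)
  rw [Finset.card_eq_sum_card_fiberwise (f := home) (t := Finset.range κ)
    (fun Q hQ => Finset.mem_coe.2 (Finset.mem_range.2 (hlt Q hQ))),
    ← Finset.sum_add_distrib] at h1
  refine h1.trans ?_
  have h2 : excess f κ 𝒞 + κ + 2 * {i ∈ Finset.range κ | IsCandidate f 𝒞 i}.card =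
      ∑ i ∈ Finset.range κ, ((pureClusters f 𝒞 i).card - 1 + 1 +
        2 * if IsCandidate f 𝒞 i then 1 else 0) := by
    rw [Finset.card_filter, excess, Finset.sum_add_distrib, Finset.sum_add_distrib,
      Finset.mul_sum, Finset.sum_const, Finset.card_range, smul_eq_mul, mul_one]
  rw [h2]
  refine Finset.sum_le_sum fun i hi => ?_
  have hi := Finset.mem_range.1 hi
  set F := {Q ∈ mixedClusters f κ 𝒞 | home Q = i} with hF
  have hF1 : ∀ Q ∈ F, Q ∈ mixedClusters f κ 𝒞 ∧ BelongsTo P f Q i := by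
    intro Q hQ
    obtain ⟨hQm, rfl⟩ := Finset.mem_filter.1 hQ
    exact ⟨hQm, hhome Q hQm⟩
  have hF𝒞 : ∀ Q ∈ F, Q ∈ 𝒞 := fun Q hQ => hsub (hF1 Q hQ).1
  have htouch : ∀ Q ∈ F, ∃ x ∈ Q, f x = i := fun Q hQ =>
    (hF1 Q hQ).2.exists_mem h hf (hF𝒞 Q hQ) hi
  have h3 : F.card ≤ 2 := card_mixed_touching_le_two h hf hi hF𝒞
    (fun Q hQ => not_pure_of_mem_mixedClusters h hf (hF1 Q hQ).1 i) htouch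
  by_cases hcand : IsCandidate f 𝒞 i
  · rw [if_pos hcand]
    omega
  -- Two clusters at home in `i`, or one and a pure cluster, would be two clusters centered at `i`.
  · have h4 : F.card ≤ 1 := by
      by_contra! hlt
      obtain ⟨X, hX, Y, hY, hne⟩ := Finset.one_lt_card.1 hlt
      exact hcand ⟨X, hF𝒞 X hX, Y, hF𝒞 Y hY, hne,
        (hF1 X hX).2.isCentered h (hF𝒞 X hX) (hF𝒞 Y hY) hne (htouch Y hY),
        (hF1 Y hY).2.isCentered h (hF𝒞 Y hY) (hF𝒞 X hX) hne.symm (htouch X hX)⟩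
    have h5 : F.card = 0 ∨ (pureClusters f 𝒞 i).card = 0 := by
      by_contra! hcon
      obtain ⟨X, hX⟩ := Finset.card_pos.1 (Nat.pos_of_ne_zero hcon.1)
      obtain ⟨Y, hY⟩ := Finset.card_pos.1 (Nat.pos_of_ne_zero hcon.2)
      obtain ⟨hY𝒞, hYi⟩ := mem_pureClusters.1 hY
      have hne : X ≠ Y := by
        rintro rfl
        exact not_pure_of_mem_mixedClusters h hf (hF1 X hX).1 i hYi
      obtain ⟨y, hy⟩ := h.nonempty Y hY𝒞
      exact hcand ⟨X, hF𝒞 X hX, Y, hY𝒞, hne,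
        (hF1 X hX).2.isCentered h (hF𝒞 X hX) hY𝒞 hne ⟨y, hy, hYi y hy⟩, isCentered_of_pure hYi⟩
    rw [if_neg hcand]
    omega

/-! ### The charging argument -/

open Classical in
/-- A bound for the sum of a monotone sequence `e 0, …, e (J - 1)`, some of whose members are
marked by `G`. An unmarked member is paid for by a later marked member, by a bound `M / p J`, or
by one of many weights `β i`, of which each is used at most four times. -/
theorem sum_le_of_monotone {J : ℕ} {e : ℕ → ℝ} (he : ∀ v t, v ≤ t → t < J → e v ≤ e t)
    (G : ℕ → Prop) (p : ℕ → ℕ) {M : ℝ} (hM : 0 ≤ M)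
    (hp : ∀ t < J, p (t + 1) ≤ p t) (hpG : ∀ t < J, p t ≤ p (t + 1) + 2)
    (hpB : ∀ t < J, ¬G t → p t ≤ p (t + 1)) (hpM : ∀ t < J, (p t : ℝ) * e t ≤ M)
    (he0 : ∀ t < J, 0 ≤ e t)
    (N : Finset ℕ) {β : ℕ → ℝ} (hβ : ∀ i ∈ N, 0 ≤ β i) (S : ℕ → Finset ℕ) (hSN : ∀ t, S t ⊆ N)
    (hS : ∀ t < J, J - t ≤ p t + 2 * (S t).card) (hSβ : ∀ t < J, ∀ i ∈ S t, e t ≤ β i) :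
    ∑ t ∈ Finset.range J, e t ≤
      2 * ∑ t ∈ Finset.range J with G t, e t + 2 * M + 4 * ∑ i ∈ N, β i := by
  have hpJ : ∀ v ≤ J, p J ≤ p v := by
    intro v hv
    induction hv using Nat.decreasingInduction with
    | self => exact le_rfl
    | of_succ v hv ih => exact ih.trans (hp v hv)
  have hMJ : ∀ t < J, 0 < p J → e t ≤ M / p J := by
    intro t ht hpos
    rw [le_div_iff₀ (by exact_mod_cast hpos), mul_comm]
    have h1 : (p J : ℝ) ≤ p t := by exact_mod_cast hpJ t ht.le
    exact (mul_le_mul_of_nonneg_right h1 (he0 t ht)).trans (hpM t ht)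
  -- From `v` on: `nB` unmarked and `nG` marked members, `g` marked ones not yet used, `n` unmarked
  -- ones not paid by a marked one, `m` of these paid by `M / p J`, and `load i` by `β i`. Going
  -- backward lets monotonicity bound `e v` by every later member; `y` keeps the value of the `g`
  -- unused ones.
  have key : ∀ v ≤ J, ∃ nB nG g n m : ℕ, ∃ load : ℕ → ℕ,
      nB + nG = J - v ∧ p v ≤ p J + 2 * nG ∧ nB + g = nG + n ∧ m ≤ n ∧ m ≤ 2 * p J ∧
      ∑ i ∈ N, load i + m ≤ n ∧ (∀ i, load i ≤ 4) ∧
      ∀ y, (∀ t, v ≤ t → t < J → y ≤ e t) →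
        ∑ t ∈ Finset.Ico v J with ¬G t, e t + g * y ≤
          ∑ t ∈ Finset.Ico v J with G t, e t + m * (M / p J) + ∑ i ∈ N, load i * β i := by
    intro v hv
    induction hv using Nat.decreasingInduction with
    | self => exact ⟨0, 0, 0, 0, 0, fun _ => 0, by simp⟩
    | of_succ v hv ih =>
      obtain ⟨nB, nG, g, n, m, load, h1, h2, h3, h4, h5, h6, h7, h8⟩ := ih
      have hI : Finset.Ico v J = insert v (Finset.Ico (v + 1) J) :=
        (Finset.insert_Ico_add_one_left_eq_Ico hv).symm
      by_cases hG : G v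
      · refine ⟨nB, nG + 1, g + 1, n, m, load, by omega, by have := hpG v hv; omega, by omega,
          h4, h5, h6, h7, fun y hy => ?_⟩
        rw [hI, Finset.filter_insert, Finset.filter_insert, if_pos hG, if_neg (not_not.2 hG),
          Finset.sum_insert (by simp)]
        have := h8 y fun t ht => hy t (by omega)
        have := hy v le_rfl hv
        push_cast
        linarith
      · have hpv := hpB v hv hG
        have hsumG : ∑ t ∈ Finset.Ico v J with G t, e t =
            ∑ t ∈ Finset.Ico (v + 1) J with G t, e t := by
          rw [hI, Finset.filter_insert, if_neg hG]
        have hsumB : ∑ t ∈ Finset.Ico v J with ¬G t, e t =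
            e v + ∑ t ∈ Finset.Ico (v + 1) J with ¬G t, e t := by
          rw [hI, Finset.filter_insert, if_pos hG, Finset.sum_insert (by simp)]
        have h9 := h8 (e v) fun t ht htJ => he v t (by omega) htJ
        rcases Nat.eq_zero_or_pos g with rfl | hg
        · by_cases hn : n + 1 ≤ 2 * p J
          · refine ⟨nB + 1, nG, 0, n + 1, m + 1, load, by omega, by omega, by omega, by omega,
              by omega, by omega, h7, fun y hy => ?_⟩
            have := hMJ v hv (by omega)
            rw [hsumG, hsumB]
            push_cast at h9 ⊢
            linarith
          · have hSv := hS v hv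
            -- Here `n ≥ 2 * p J`, while counting gives `n + 1 ≤ p J + 2 * (S v).card`. If all of `S
            -- v` were used four times, then `4 * (S v).card ≤ n`, and the right side would be at
            -- most `n`.
            have hex : ∃ i ∈ S v, load i < 4 := by
              by_contra! hcon
              have h10 : (S v).card • 4 ≤ ∑ i ∈ S v, load i :=
                Finset.card_nsmul_le_sum _ _ _ hcon
              have h11 : ∑ i ∈ S v, load i ≤ ∑ i ∈ N, load i :=
                Finset.sum_le_sum_of_subset (hSN v)
              rw [smul_eq_mul] at h10
              omega
            obtain ⟨i, hi, hil⟩ := hex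
            have hiN := hSN v hi
            refine ⟨nB + 1, nG, 0, n + 1, m, Function.update load i (load i + 1), by omega,
              by omega, by omega, by omega, h5, ?_, fun j => ?_, fun y hy => ?_⟩
            · rw [Finset.sum_update_of_mem hiN]
              have := Finset.add_sum_erase N load hiN
              rw [Finset.erase_eq] at this
              omega
            · rcases eq_or_ne j i with rfl | hj
              · rw [Function.update_self]
                exact hil
              · rw [Function.update_of_ne hj]
                exact h7 j
            · have h12 : ∑ j ∈ N, (Function.update load i (load i + 1) j : ℝ) * β j =
                  ∑ j ∈ N, (load j : ℝ) * β j + β i := by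
                rw [← Finset.add_sum_erase N _ hiN,
                  ← Finset.add_sum_erase N (fun j => (load j : ℝ) * β j) hiN,
                  Function.update_self]
                have : ∑ j ∈ N.erase i, (Function.update load i (load i + 1) j : ℝ) * β j =
                    ∑ j ∈ N.erase i, (load j : ℝ) * β j :=
                  Finset.sum_congr rfl fun j hj => by
                    rw [Function.update_of_ne (Finset.ne_of_mem_erase hj)]
                rw [this]
                push_cast
                ring
              have := hSβ v hv i hi
              rw [hsumG, hsumB, h12]
              push_cast at h9 ⊢
              linarith
        · obtain ⟨g, rfl⟩ := Nat.exists_eq_succ_of_ne_zero hg.ne'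
          refine ⟨nB + 1, nG, g, n, m, load, by omega, by omega, by omega, h4, h5, h6, h7,
            fun y hy => ?_⟩
          have h10 : (g : ℝ) * y ≤ g * e v :=
            mul_le_mul_of_nonneg_left (hy v le_rfl hv) (Nat.cast_nonneg g)
          rw [hsumG, hsumB]
          push_cast at h9
          linarith
  obtain ⟨nB, nG, g, n, m, load, -, -, -, -, h5, -, h7, h8⟩ := key 0 (Nat.zero_le J)
  have h9 : ∑ t ∈ Finset.range J with ¬G t, e t + g * 0 ≤
      ∑ t ∈ Finset.range J with G t, e t + m * (M / p J) + ∑ i ∈ N, load i * β i := by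
    rw [Finset.range_eq_Ico]
    exact h8 0 fun t _ ht => he0 t ht
  have h10 : (m : ℝ) * (M / p J) ≤ 2 * M := by
    -- If `p J = 0`, the quotient `M / p J` is `0` by convention.
    rcases Nat.eq_zero_or_pos (p J) with hz | hpos
    · rw [hz, Nat.cast_zero, div_zero, mul_zero]
      linarith
    · have hpos' : (0 : ℝ) < p J := by exact_mod_cast hpos
      have hm : (m : ℝ) ≤ 2 * p J := by exact_mod_cast h5
      calc (m : ℝ) * (M / p J) ≤ 2 * p J * (M / p J) := by gcongr
        _ = 2 * M := by field_simp
  have h11 : ∑ i ∈ N, load i * β i ≤ 4 * ∑ i ∈ N, β i := by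
    rw [Finset.mul_sum]
    refine Finset.sum_le_sum fun i hi => mul_le_mul_of_nonneg_right ?_ (hβ i hi)
    exact_mod_cast h7 i
  have h12 := Finset.sum_filter_add_sum_filter_not (Finset.range J) G e
  linarith

/-! ### Ward's cost against an interval coloring -/

theorem card_near_le (i : ℕ) : (near i).card ≤ 3 := by
  rw [near, Nat.card_Icc]
  omega

/-- Each color is near at most three colors. The set `near (κ - 1)` can reach `κ`, where `hgκ` makes
`g` vanish. -/
theorem sum_sum_near_le {g : ℕ → ℝ} (hg : ∀ i, 0 ≤ g i) (hgκ : ∀ i, κ ≤ i → g i = 0) :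
    ∑ i ∈ Finset.range κ, ∑ j ∈ near i, g j ≤ 3 * ∑ j ∈ Finset.range κ, g j := by
  have h1 : ∀ i, ∑ j ∈ near i, g j = ∑ j ∈ near i with j < κ, g j := fun i =>
    (Finset.sum_filter_of_ne fun j _ hj => by
      by_contra hle
      exact hj (hgκ j (not_lt.1 hle))).symm
  rw [Finset.sum_congr rfl fun i _ => h1 i,
    Finset.sum_comm' (t' := Finset.range κ) (s' := fun j => {i ∈ near j | i < κ}), Finset.mul_sum]
  · refine Finset.sum_le_sum fun j _ => ?_
    rw [Finset.sum_const, nsmul_eq_mul]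
    refine mul_le_mul_of_nonneg_right ?_ (hg j)
    exact_mod_cast (Finset.card_filter_le _ _).trans (card_near_le j)
  · intro i j
    simp only [near, Finset.mem_filter, Finset.mem_range, Finset.mem_Icc]
    omega

theorem colorCost_eq_zero (hf : IsIntervalColoring P κ f) (c : ℕ → ℝ) {i : ℕ} (hi : κ ≤ i) :
    colorCost P f c i = 0 := by
  refine Finset.sum_eq_zero fun x hx => ?_
  rw [Finset.mem_filter] at hx
  have := hf.lt x hx.1
  omega

open Classical in
theorem hierarchicalCost_le_sum_colorCost {k : ℕ} (hk : 1 ≤ k) (hkP : k ≤ P.card)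
    {W : ℕ → Finset (Finset ℝ)} (hW : IsWardClustering P W) (hf : IsIntervalColoring P κ f)
    (hκ : κ ≤ k) (c : ℕ → ℝ) :
    hierarchicalCost P W k ≤ 18008 * ∑ i ∈ Finset.range κ, colorCost P f c i := by
  have hstep := hW.step
  choose! A B hAB using hstep
  set J := P.card - k with hJ
  have hlt : ∀ t < J, t + 1 < P.card := fun t ht => by omega
  have hpart : ∀ t < P.card, IsIntervalPartition P (W t) := by
    intro t
    induction t with
    | zero =>
      intro _
      rw [hW.init]
      exact isIntervalPartition_singletons P
    | succ t ih =>
      intro ht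
      rw [(hAB t ht).2]
      exact (ih (by omega)).merge (hAB t ht).1
  have hpart' : ∀ t < J, IsIntervalPartition P (W t) := fun t ht => hpart t (by omega)
  have hg : ∀ t < J, IsGreedyMerge (W t) (A t) (B t) := fun t ht => (hAB t (hlt t ht)).1
  have hm : ∀ t < J, W (t + 1) = merge (W t) (A t) (B t) := fun t ht => (hAB t (hlt t ht)).2
  have hcard : ∀ t ≤ J, (W t).card + t = P.card := by
    intro t
    induction t with
    | zero =>
      intro _
      rw [hW.init, Finset.card_image_of_injective _ Finset.singleton_injective, add_zero]
    | succ t ih =>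
      intro ht
      have h1 := card_merge (hpart' t ht) (hg t ht)
      have h2 := ih (by omega)
      rw [hm t ht]
      omega
  set e : ℕ → ℝ := fun t => mergeCost (A t) (B t) with he
  have he0 : ∀ t < J, 0 ≤ e t := fun t ht => mergeCost_nonneg ((hg t ht).disjoint (hpart' t ht))
  have hmono : ∀ v t, v ≤ t → t < J → e v ≤ e t := by
    intro v t hvt
    induction t, hvt using Nat.le_induction with
    | base => exact fun _ => le_rfl
    | succ t _ ih =>
      intro ht
      have ht' : t < J := by omega
      obtain ⟨hA, hB, hne, -⟩ := hg (t + 1) ht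
      rw [hm t ht'] at hA hB
      exact (ih ht').trans ((hg t ht').le_of_merge (hpart' t ht') hA hB hne)
  have hsum : ∀ t ≤ J, ∑ Q ∈ W t, cost Q = ∑ s ∈ Finset.range t, e s := by
    intro t
    induction t with
    | zero =>
      intro _
      rw [hW.init, Finset.range_zero, Finset.sum_empty]
      refine Finset.sum_eq_zero fun Q hQ => ?_
      obtain ⟨x, -, rfl⟩ := Finset.mem_image.1 hQ
      exact cost_singleton x
    | succ t ih =>
      intro ht
      rw [hm t ht, sum_cost_merge (hpart' t ht) (hg t ht), ih (by omega), Finset.sum_range_succ]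
  set OPT := ∑ i ∈ Finset.range κ, colorCost P f c i with hOPT
  have hOPT0 : 0 ≤ OPT := Finset.sum_nonneg fun i _ => colorCost_nonneg P f c i
  set Φ : ℕ → ℝ := fun t => ∑ i ∈ Finset.range κ, potential f c (W t) i with hΦ
  have hΦ0 : Φ 0 ≤ OPT := Finset.sum_le_sum fun i _ => by
    rw [hW.init]
    exact potential_singletons_le P f c i
  have hΦnonneg : ∀ t, 0 ≤ Φ t := fun t =>
    Finset.sum_nonneg fun i _ => potential_nonneg f c (W t) i
  have hΦstep : ∀ t < J, Φ (t + 1) ≤ Φ t := by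
    intro t ht
    simp only [hΦ]
    rw [hm t ht]
    exact sum_potential_merge_le (hpart' t ht) (hg t ht) f c _
  have hΦle : ∀ t ≤ J, Φ t ≤ OPT := by
    intro t
    induction t with
    | zero => exact fun _ => hΦ0
    | succ t ih => exact fun ht => (hΦstep t ht).trans (ih (by omega))
  set G : ℕ → Prop := fun t => IsInnerMerge f (W t) (A t) (B t) with hGdef
  have hG : ∀ t < J, G t → e t ≤ 2 * (Φ t - Φ (t + 1)) := by
    rintro t ht ⟨i, hi, h2⟩
    simp only [hΦ]
    rw [hm t ht]
    refine sum_potential_merge_le_sub (hpart' t ht) (hg t ht) c (Finset.mem_range.2 ?_) hi h2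
    obtain ⟨Q, hQ⟩ := Finset.card_pos.1 (zero_lt_two.trans_le h2)
    obtain ⟨hQ, hQi⟩ := mem_pureClusters.1 hQ
    obtain ⟨x, hx⟩ := (hpart' t ht).nonempty Q hQ
    exact hQi x hx ▸ hf.lt x ((hpart' t ht).subset Q hQ hx)
  have hGsum : ∀ t ≤ J, ∑ s ∈ Finset.range t with G s, e s ≤ 2 * (Φ 0 - Φ t) := by
    intro t
    induction t with
    | zero => simp
    | succ t ih =>
      intro ht
      have h1 := ih (by omega)
      have h2 := hΦstep t ht
      rw [Finset.range_add_one, Finset.filter_insert]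
      split_ifs with hGt
      · rw [Finset.sum_insert (by simp)]
        have := hG t ht hGt
        linarith
      · linarith
  -- At most three colors are near `i`, whence `5 ^ 3`; initially `localCost` is at most twice the
  -- color costs, whence `3 = 1 + 2`.
  have hlocal : ∀ i, ∀ t < P.card, IsCandidate f (W t) i →
      5 ^ numPure f (near i) (W t) * (∑ j ∈ near i, colorCost P f c j +
        localCost f c (near i) (W t)) ≤ 5 ^ 3 * (3 * ∑ j ∈ near i, colorCost P f c j) := by
    intro i t
    have hb : 0 ≤ ∑ j ∈ near i, colorCost P f c j :=
      Finset.sum_nonneg fun j _ => colorCost_nonneg P f c j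
    induction t with
    | zero =>
      intro _ _
      rw [hW.init]
      have h1 := localCost_singletons_le P f c (near i)
      have h2 : numPure f (near i) (P.image fun x => {x}) ≤ 3 :=
        (Finset.card_filter_le _ _).trans (card_near_le i)
      have h3 : (5 : ℝ) ^ numPure f (near i) (P.image fun x => {x}) ≤ 5 ^ 3 :=
        pow_le_pow_right₀ (by norm_num) h2
      exact mul_le_mul h3 (by linarith) (add_nonneg hb (add_nonneg
        (Finset.sum_nonneg fun Q _ => cost_nonneg Q) (mul_nonneg two_pos.le
          (Finset.sum_nonneg fun j _ => potential_nonneg f c _ j)))) (by positivity)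
    | succ t ih =>
      intro ht hi
      have hpt := hpart t (by omega)
      rw [(hAB t ht).2] at hi ⊢
      exact add_localCost_merge_le hpt hf (hAB t ht).1 c hi rfl
        (ih (by omega) (hi.of_merge hpt (hAB t ht).1))
  -- `1500 = 4 * 5 ^ 3 * 3`.
  have hcand : ∀ t < J, ∀ i, IsCandidate f (W t) i →
      e t ≤ 1500 * ∑ j ∈ near i, colorCost P f c j := by
    intro t ht i hi
    have h1 := mergeCost_le_of_isCandidate (hpart' t ht) (hg t ht) c hi
    have h2 := hlocal i t (by omega) hi
    have h3 : (1 : ℝ) ≤ 5 ^ numPure f (near i) (W t) := one_le_pow₀ (by norm_num)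
    have h4 : 0 ≤ ∑ j ∈ near i, colorCost P f c j + localCost f c (near i) (W t) := by
      have := he0 t ht
      linarith
    have h5 := mul_le_mul_of_nonneg_right h3 h4
    simp only [he]
    linarith
  have hmain := sum_le_of_monotone hmono G (fun t => excess f κ (W t)) (M := 2 * OPT)
    (by linarith) (fun t ht => by simpa only [hm t ht] using excess_merge_le (hg t ht) f κ)
    (fun t ht => by simpa only [hm t ht] using excess_le_add_two (hpart' t ht) (hg t ht) f κ)
    (fun t ht hGt => by simpa only [hm t ht] using excess_le_of_not_inner (hg t ht) hGt κ)
    (fun t ht => (excess_mul_mergeCost_le (hpart' t ht) (hg t ht) f c κ).trans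
      (mul_le_mul_of_nonneg_left (hΦle t ht.le) two_pos.le))
    he0 (Finset.range κ) (β := fun i => 1500 * ∑ j ∈ near i, colorCost P f c j)
    (fun i _ => mul_nonneg (by norm_num)
      (Finset.sum_nonneg fun j _ => colorCost_nonneg P f c j))
    (fun t => {i ∈ Finset.range κ | IsCandidate f (W t) i}) (fun t => Finset.filter_subset _ _)
    -- There are `|P| - t = k + (J - t)` clusters, and `κ ≤ k`.
    (fun t ht => by
      have h1 := card_le_excess_add (hpart' t ht) hf
      have h2 := hcard t ht.le
      omega)
    (fun t ht i hi => hcand t ht i (Finset.mem_filter.1 hi).2)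
  rw [← Finset.mul_sum] at hmain
  have h1 := sum_sum_near_le (fun i => colorCost_nonneg P f c i)
    (fun i hi => colorCost_eq_zero hf c hi)
  have h2 := hGsum J le_rfl
  have h3 := hΦnonneg J
  -- `18008 = 2 * 2 + 2 * 2 + 4 * 1500 * 3`: inner merges, excess, candidates.
  rw [hierarchicalCost, ← hJ, hsum J le_rfl]
  linarith

/-! ### From centers to interval colorings -/

theorem exists_nearest_monotone {C : Finset ℝ} (hC : C.Nonempty) :
    ∃ g : ℝ → ℝ, Monotone g ∧ ∀ x, g x ∈ C ∧ ∀ d ∈ C, (x - g x) ^ 2 ≤ (x - d) ^ 2 := by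
  -- Ties go to the leftmost nearest center; the strict inequality makes the choice monotone.
  have hex : ∀ x : ℝ, ∃ a ∈ C, (∀ d ∈ C, (x - a) ^ 2 ≤ (x - d) ^ 2) ∧
      ∀ d ∈ C, d < a → (x - a) ^ 2 < (x - d) ^ 2 := by
    intro x
    have hne : {a ∈ C | ∀ d ∈ C, (x - a) ^ 2 ≤ (x - d) ^ 2}.Nonempty := by
      obtain ⟨a, ha, hmin⟩ := C.exists_min_image (fun a => (x - a) ^ 2) hC
      exact ⟨a, Finset.mem_filter.2 ⟨ha, hmin⟩⟩
    have hmem := Finset.mem_filter.1 (Finset.min'_mem _ hne)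
    refine ⟨_, hmem.1, hmem.2, fun d hd hlt => ?_⟩
    by_contra! hle
    exact absurd (Finset.min'_le _ d (Finset.mem_filter.2
      ⟨hd, fun d' hd' => hle.trans (hmem.2 d' hd')⟩)) (not_le.2 hlt)
  choose g hgC hgmin hglt using hex
  refine ⟨g, fun x y hxy => ?_, fun x => ⟨hgC x, hgmin x⟩⟩
  by_contra! hlt
  have h1 := hglt x (g y) (hgC y) hlt
  have h2 := hgmin y (g x) (hgC x)
  nlinarith [mul_nonneg (sub_nonneg.2 hxy) (sub_nonneg.2 hlt.le)]

theorem exists_coloring (P : Finset ℝ) {C : Finset ℝ} (hC : C.Nonempty) :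
    ∃ κ ≤ C.card, ∃ (f : ℝ → ℕ) (c : ℕ → ℝ), IsIntervalColoring P κ f ∧
      ∑ i ∈ Finset.range κ, colorCost P f c i ≤ kMeansCost P C := by
  obtain ⟨g, hmono, hg⟩ := exists_nearest_monotone hC
  have hI : ∀ x ∈ P, g x ∈ P.image g := fun x hx => Finset.mem_image_of_mem g hx
  let σ := (P.image g).orderIsoOfFin rfl
  let f : ℝ → ℕ := fun x => if h : g x ∈ P.image g then (σ.symm ⟨g x, h⟩ : ℕ) else 0
  let c : ℕ → ℝ := fun i => if h : i < (P.image g).card then (σ ⟨i, h⟩ : ℝ) else 0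
  have hfx : ∀ x (hx : x ∈ P), f x = σ.symm ⟨g x, hI x hx⟩ := fun x hx => dif_pos (hI x hx)
  have hlt : ∀ x ∈ P, f x < (P.image g).card := fun x hx => by
    rw [hfx x hx]
    exact (σ.symm ⟨g x, hI x hx⟩).isLt
  have hcf : ∀ x ∈ P, c (f x) = g x := by
    intro x hx
    simp only [c]
    rw [dif_pos (hlt x hx)]
    have : (⟨f x, hlt x hx⟩ : Fin (P.image g).card) = σ.symm ⟨g x, hI x hx⟩ :=
      Fin.ext (hfx x hx)
    rw [this, OrderIso.apply_symm_apply]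
  refine ⟨(P.image g).card, ?_, f, c, ⟨hlt, ?_, ?_⟩, ?_⟩
  · exact Finset.card_le_card (Finset.image_subset_iff.2 fun x _ => (hg x).1)
  · intro i hi
    obtain ⟨x, hx, hxi⟩ := Finset.mem_image.1 (σ ⟨i, hi⟩).2
    refine ⟨x, hx, ?_⟩
    have : (⟨g x, hI x hx⟩ : (P.image g : Finset ℝ)) = σ ⟨i, hi⟩ := Subtype.ext hxi
    rw [hfx x hx, this, OrderIso.symm_apply_apply]
  · intro x hx y hy hxy
    rw [hfx x hx, hfx y hy]
    exact σ.symm.monotone (show (⟨g x, hI x hx⟩ : (P.image g : Finset ℝ)) ≤ ⟨g y, hI y hy⟩ from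
      hmono hxy)
  · have h1 : ∑ i ∈ Finset.range (P.image g).card, colorCost P f c i =
        ∑ x ∈ P, (x - c (f x)) ^ 2 := by
      rw [← Finset.sum_fiberwise_of_maps_to (s := P) (t := Finset.range (P.image g).card) (g := f)
        fun x hx => Finset.mem_range.2 (hlt x hx)]
      refine Finset.sum_congr rfl fun i _ => Finset.sum_congr rfl fun x hx => ?_
      rw [(Finset.mem_filter.1 hx).2]
    rw [h1]
    refine Finset.sum_le_sum fun x hx => ?_
    have : Nonempty C := hC.to_subtype
    rw [hcf x hx]
    exact le_ciInf fun d => (hg x).2 d d.2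

end Ward

theorem mainTheorem3 :
    ∃ α : ℝ, ∀ (P : Finset ℝ) (k : ℕ), 1 ≤ k → k ≤ P.card →
      ∀ W : ℕ → Finset (Finset ℝ), Ward.IsWardClustering P W →
        Ward.hierarchicalCost P W k ≤ α * Ward.opt k P := by
  refine ⟨18008, fun P k hk hkP W hW => ?_⟩
  rw [mul_comm, ← div_le_iff₀ (by norm_num)]
  refine le_csInf ?_ ?_
  -- The infimum must range over a nonempty set; `k` points of `P` serve as centers.
  · obtain ⟨C, -, hC⟩ := Finset.exists_subset_card_eq hkP
    exact ⟨_, C, hC, rfl⟩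
  · rintro v ⟨C, hC, rfl⟩
    have hne : C.Nonempty := Finset.card_pos.1 (hC ▸ hk)
    obtain ⟨κ, hκ, f, c, hf, hle⟩ := Ward.exists_coloring P hne
    have := Ward.hierarchicalCost_le_sum_colorCost hk hkP hW hf (hC ▸ hκ) c
    rw [div_le_iff₀ (by norm_num)]
    linarith
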